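/- Let $a \neq \pm 1$ be a squarefree integer and let $u$ be a positive integer with $\gcd(u,30)=1$. Suppose the polynomial $F(x) = x^{60} - a^u \in \mathbb{Z}[x]$ is irreducible, let $\alpha \in \mathbb{C}$ be a root of $F$, and let $K = \mathbb{Q}(\alpha)$, with ring of integers $\mathbb{Z}_K$. Call $K$ monogenic if there is $\theta \in \mathbb{Z}_K$ with $K = \mathbb{Q}(\theta)$ and $\mathbb{Z}_K = \mathbb{Z}[\theta]$. 1. If $a \not\equiv 1 \pmod 4$, $a \not\equiv \pm 1 \pmod 9$ and $a \not\equiv \pm 1, \pm 7 \pmod{25}$, then $K$ is monogenic. 2. If $a \equiv 1 \pmod 4$, or $a \equiv \pm 1 \pmod 9$, or $a \equiv \pm 1 \pmod{25}$, then $K$ is not monogenic. -/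

import Mathlib

open Polynomial IntermediateField

/-- A field `K` of characteristic zero (used for number fields) is *monogenic* if some generator
`θ` of `K` over `ℚ` lying in the ring of integers `𝓞 K` satisfies `ℤ[θ] = 𝓞 K`, i.e. the index
`(𝓞 K : ℤ[θ])` is `1`. -/
def IsMonogenicField (K : Type*) [Field K] [CharZero K] : Prop :=
  ∃ θ : NumberField.RingOfIntegers K,
    ℚ⟮(θ : K)⟯ = ⊤ ∧
      Algebra.adjoin ℤ ({θ} : Set (NumberField.RingOfIntegers K)) = ⊤

/-! Since `u` is prime to 60, a power of `α` divided by a power of `a` is a generator `b` of K with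
minimal polynomial X^60 - a, so `u` plays no further role.

Positive part: ℤ[b] is the full ring of integers. It suffices that each nonzero maximal ideal P,
over a prime p, is locally generated by one element π. Take π = b if p ∣ a (`a` is squarefree), π =
p if p ∤ 60a, and π = b^N - a if 60 = N p^e with p ∣ 60 and p ∤ a. In the last case π divides a -
a^(p^e), which p divides exactly once; the congruence hypotheses say just this
(`isIntegrallyClosed_localization_of_pow_sub`).

Negative part: if 𝓞 K = ℤ[θ], a homomorphism 𝓞 K → k is determined by the image of θ, so a finite
field k receives few of them (`not_isMonogenicField_of_card_lt`). Under each congruence there is an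
integral element η outside ℤ[b], namely (b^30 - 1)/2, or (1 + D + ⋯ + D^(p-1))/p with D = ±b^(60/p)
for p = 3, 5. Too many pairs of values for (b, η) then occur. Each pair is realised by finding a
60th root of `a` in the Witt vectors of k, or in an Eisenstein extension of them: K embeds in the
fraction field, 𝓞 K lands in the integrally closed ring, and one reduces to k
(`exists_residue_hom`). -/

/-! ### Local principality and the integral closedness of ℤ[b] -/

/-- A noetherian domain is integrally closed at a maximal ideal that is locally generated by one
element. -/
lemma isIntegrallyClosed_localization_of_locally_principal {R : Type*} [CommRing R] [IsDomain R]
    [IsNoetherianRing R] (P : Ideal R) [P.IsMaximal] (π : R) (hπ : π ∈ P)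
    (h : ∀ r ∈ P, ∃ s ∉ P, π ∣ s * r) : IsIntegrallyClosed (Localization.AtPrime P) := by
  have : IsNoetherianRing (Localization.AtPrime P) :=
    IsLocalization.isNoetherianRing P.primeCompl _ inferInstance
  have key : IsLocalRing.maximalIdeal (Localization.AtPrime P) =
      Ideal.span {algebraMap R (Localization.AtPrime P) π} := by
    rw [← Localization.AtPrime.map_eq_maximalIdeal]
    apply le_antisymm
    · rw [Ideal.map_le_iff_le_comap]
      intro r hr
      obtain ⟨s, hs, t, ht⟩ := h r hr
      rw [Ideal.mem_comap, Ideal.mem_span_singleton]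
      have hu : IsUnit (algebraMap R (Localization.AtPrime P) s) :=
        IsLocalization.map_units _ (⟨s, hs⟩ : P.primeCompl)
      rw [← hu.dvd_mul_left, ← map_mul, ht, map_mul]
      exact dvd_mul_right _ _
    · rw [Ideal.span_singleton_le_iff_mem]
      exact Ideal.mem_map_of_mem _ hπ
  have hprinc : (IsLocalRing.maximalIdeal (Localization.AtPrime P)).IsPrincipal := ⟨_, key⟩
  have hiff := (tfae_of_isNoetherianRing_of_isLocalRing_of_isDomain
    (Localization.AtPrime P)).out 4 3
  exact (hiff.mp hprinc).1

/-- If some power of Frobenius fixes the generator modulo `(p, π)`, then the quotient by `(p, π)`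
is reduced, so that `π` generates `P` locally as soon as it divides `p` locally. -/
lemma exists_dvd_mul_of_frobenius_fixed {R : Type*} [CommRing R] (P : Ideal R)
    [P.IsMaximal] {β : R} (hβ : Algebra.adjoin ℤ {β} = ⊤) {p k : ℕ} (hp : p.Prime) (hk : k ≠ 0)
    (hpP : (p : R) ∈ P) {π : R} (hπ : π ∈ P) (hfix : β ^ p ^ k - β ∈ Ideal.span {(p : R), π})
    (hs : ∃ s ∉ P, π ∣ s * p) : ∀ r ∈ P, ∃ s ∉ P, π ∣ s * r := by
  intro r hr
  set I : Ideal R := Ideal.span {(p : R), π} with hI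
  have hIP : I ≤ P := by
    rw [hI, Ideal.span_le]
    rintro x (rfl | rfl)
    · exact hpP
    · exact hπ
  have hItop : I ≠ ⊤ := fun h => (inferInstance : P.IsMaximal).ne_top (top_le_iff.mp (h ▸ hIP))
  have : Nontrivial (R ⧸ I) := Ideal.Quotient.nontrivial_iff.mpr hItop
  have : Fact p.Prime := ⟨hp⟩
  have hp0 : (p : R ⧸ I) = 0 := by
    rw [← map_natCast (Ideal.Quotient.mk I), Ideal.Quotient.eq_zero_iff_mem]
    exact Ideal.subset_span (by simp)
  have : CharP (R ⧸ I) p := ringChar.of_eq (CharP.ringChar_of_prime_eq_zero hp hp0)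
  have heq : ((iterateFrobenius (R ⧸ I) p k).comp (Ideal.Quotient.mk I)).toIntAlgHom =
      (Ideal.Quotient.mk I).toIntAlgHom := by
    apply AlgHom.ext_of_adjoin_eq_top hβ
    rintro x rfl
    have := (Ideal.Quotient.eq (I := I)).mpr hfix
    simpa [iterateFrobenius_def] using this
  have hr' : r ^ p ^ k - r ∈ I := by
    rw [← Ideal.Quotient.eq]
    have := congrArg (fun f => f r) heq
    simpa [iterateFrobenius_def] using this
  obtain ⟨s, hsP, w, hw⟩ := hs
  obtain ⟨x, y, hxy⟩ := Ideal.mem_span_pair.mp hr'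
  obtain ⟨n, hn⟩ : ∃ n, p ^ k = n + 2 := ⟨p ^ k - 2, by
    have := hp.two_le.trans (Nat.le_self_pow hk p); omega⟩
  -- With q = p^k = n + 2, r^q - r = r (r^(q-1) - 1), and the second factor is outside P because r
  -- lies in P. It therefore acts as a local unit.
  refine ⟨s * (r ^ (n + 1) - 1), fun hmem => ?_, x * w + s * y, ?_⟩
  · rcases (inferInstance : P.IsPrime).mem_or_mem hmem with h | h
    · exact hsP h
    · apply (Ideal.ne_top_iff_one P).mp (inferInstance : P.IsMaximal).ne_top
      have h2 := P.sub_mem (P.mul_mem_left (r ^ n) hr) h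
      convert h2 using 1
      ring
  · rw [hn] at hxy
    linear_combination (-s) * hxy + x * hw

/-- Modulo I, Fermat gives β^M = a^(p-1) = 1 for M = N(p-1). As p is prime to M, p^φ(M) ≡ 1 mod M,
so k = φ(M) works. -/
lemma pow_frobenius_sub_mem {R : Type*} [CommRing R] (I : Ideal R) {β : R} {a : ℤ} {p N : ℕ}
    (hp : p.Prime) (hpI : (p : R) ∈ I) (hN : β ^ N - (a : R) ∈ I) (hpN : ¬ p ∣ N)
    (hpa : ¬ (p : ℤ) ∣ a) : ∃ k ≠ 0, β ^ p ^ k - β ∈ I := by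
  have : Fact p.Prime := ⟨hp⟩
  have hN0 : N ≠ 0 := by rintro rfl; exact hpN (dvd_zero _)
  have hp1 : p - 1 ≠ 0 := by have := hp.two_le; omega
  set M := N * (p - 1)
  have hM : M ≠ 0 := mul_ne_zero hN0 hp1
  have hcop : Nat.Coprime p M := by
    rw [hp.coprime_iff_not_dvd, hp.dvd_mul]
    rintro (h | h)
    · exact hpN h
    · have := Nat.le_of_dvd (Nat.pos_of_ne_zero hp1) h
      have := hp.two_le
      omega
  refine ⟨M.totient, (Nat.totient_pos.mpr (Nat.pos_of_ne_zero hM)).ne', ?_⟩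
  have h1 : 1 ≤ p ^ M.totient := Nat.one_le_pow _ _ hp.pos
  obtain ⟨j, hj⟩ := (Nat.modEq_iff_dvd' h1).mp (Nat.ModEq.pow_totient hcop).symm
  have hj' : p ^ M.totient = M * j + 1 := by omega
  have hp0 : (p : R ⧸ I) = 0 := by
    rw [← map_natCast (Ideal.Quotient.mk I), Ideal.Quotient.eq_zero_iff_mem]
    exact hpI
  have ha1 : (a : R ⧸ I) ^ (p - 1) = 1 := by
    have := Int.ModEq.pow_card_sub_one_eq_one hp (n := a) ((Nat.prime_iff_prime_int.mp hp).coprime_iff_not_dvd.mpr hpa).symm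
    obtain ⟨c, hc⟩ := this.dvd
    have h2 := congrArg (Int.cast : ℤ → R ⧸ I) hc
    push_cast at h2
    rw [hp0, zero_mul] at h2
    exact (sub_eq_zero.mp h2).symm
  have hβ : (Ideal.Quotient.mk I β) ^ N = a := by
    have := (Ideal.Quotient.eq (I := I)).mpr hN
    simpa using this
  rw [← Ideal.Quotient.eq, map_pow, hj', pow_succ, pow_mul, pow_mul, hβ, ha1, one_pow, one_mul]

/-- The local step at a prime `p` dividing `60` but not `a`. -/
lemma isIntegrallyClosed_localization_of_pow_sub {R : Type*} [CommRing R] [IsDomain R]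
    [IsNoetherianRing R] (P : Ideal R) [P.IsMaximal] {β : R} (hβ : Algebra.adjoin ℤ {β} = ⊤)
    {a : ℤ} {p N e : ℕ} (hp : p.Prime) (hpP : ∀ n : ℤ, (n : R) ∈ P ↔ (p : ℤ) ∣ n)
    (hpow : β ^ (N * p ^ e) = a) (hpN : ¬ p ∣ N) (hpa : ¬ (p : ℤ) ∣ a)
    (hsq : ¬ (p : ℤ) ^ 2 ∣ a - a ^ p ^ e) : IsIntegrallyClosed (Localization.AtPrime P) := by
  have hp' : (p : R) ∈ P := by simpa using (hpP p).mpr dvd_rfl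
  have : Fact p.Prime := ⟨hp⟩
  obtain ⟨c, hc⟩ : (p : ℤ) ∣ a - a ^ p ^ e := by
    rw [← ZMod.intCast_zmod_eq_zero_iff_dvd]
    push_cast
    rw [ZMod.pow_card_pow, sub_self]
  have hdvd : β ^ N - a ∣ ((a - a ^ p ^ e : ℤ) : R) := by
    push_cast
    rw [← hpow, pow_mul]
    exact sub_dvd_pow_sub_pow _ _ _
  have hπ : β ^ N - (a : R) ∈ P := by
    have hp0 : (p : R ⧸ P) = 0 := by
      rw [← map_natCast (Ideal.Quotient.mk P), Ideal.Quotient.eq_zero_iff_mem]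
      exact hp'
    have : CharP (R ⧸ P) p := ringChar.of_eq (CharP.ringChar_of_prime_eq_zero hp hp0)
    have h0 : ((a - a ^ p ^ e : ℤ) : R) ∈ P := (hpP _).mpr ⟨c, hc⟩
    rw [← Ideal.Quotient.eq_zero_iff_mem] at h0 ⊢
    -- In characteristic p, (β^N - a)^(p^e) = β^(N p^e) - a^(p^e) = a - a^(p^e), which vanishes
    -- modulo P.
    rw [← pow_eq_zero_iff (pow_ne_zero e hp.ne_zero), map_sub, sub_pow_char_pow, ← map_pow,
      ← pow_mul, hpow, ← h0]
    simp
  obtain ⟨k, hk, hfix⟩ := pow_frobenius_sub_mem (Ideal.span {(p : R), β ^ N - (a : R)}) (β := β) hp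
    (Ideal.subset_span (by simp)) (Ideal.subset_span (by simp)) hpN hpa
  refine isIntegrallyClosed_localization_of_locally_principal P _ hπ
    (exists_dvd_mul_of_frobenius_fixed P hβ hp hk hp' hπ hfix ⟨(c : R), ?_, ?_⟩)
  · rw [hpP]
    rintro ⟨d, rfl⟩
    exact hsq ⟨d, by rw [hc]; ring⟩
  · rw [hc] at hdvd
    rw [mul_comm]
    exact_mod_cast hdvd

lemma isIntegrallyClosed_of_pow_sixty {R : Type*} [CommRing R] [IsDomain R] [CharZero R]
    [IsNoetherianRing R] [Algebra.IsIntegral ℤ R] {β : R} (hβ : Algebra.adjoin ℤ {β} = ⊤) {a : ℤ}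
    (ha : Squarefree a) (hpow : β ^ 60 = a) (h4 : ¬ a ≡ 1 [ZMOD 4])
    (h9 : ¬ a ≡ 1 [ZMOD 9] ∧ ¬ a ≡ -1 [ZMOD 9])
    (h25 : ¬ a ≡ 1 [ZMOD 25] ∧ ¬ a ≡ -1 [ZMOD 25] ∧ ¬ a ≡ 7 [ZMOD 25] ∧ ¬ a ≡ -7 [ZMOD 25]) :
    IsIntegrallyClosed R := by
  refine IsIntegrallyClosed.of_localization_maximal fun P hP0 hP => ?_
  obtain ⟨p, hp, hpP⟩ : ∃ p : ℕ, p.Prime ∧ ∀ n : ℤ, (n : R) ∈ P ↔ (p : ℤ) ∣ n := by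
    have hpr : (P.comap (algebraMap ℤ R)).IsPrime := inferInstance
    have hne : P.comap (algebraMap ℤ R) ≠ ⊥ := fun h => hP0 (Ideal.eq_bot_of_comap_eq_bot h)
    obtain ⟨g, hg⟩ := IsPrincipalIdealRing.principal (P.comap (algebraMap ℤ R))
    have hg' : P.comap (algebraMap ℤ R) = Ideal.span {g} := hg
    have hg0 : g ≠ 0 := by rintro rfl; exact hne (hg'.trans (by simp))
    rw [hg', Ideal.span_singleton_prime hg0] at hpr
    refine ⟨g.natAbs, Int.prime_iff_natAbs_prime.mp hpr, fun n => ?_⟩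
    rw [Int.natAbs_dvd, ← Ideal.mem_span_singleton, ← hg', Ideal.mem_comap]
    simp
  have hp' : (p : R) ∈ P := by simpa using (hpP p).mpr dvd_rfl
  by_cases hpa : (p : ℤ) ∣ a
  · obtain ⟨c, rfl⟩ := hpa
    have hβP : β ∈ P := (inferInstance : P.IsPrime).mem_of_pow_mem 60
      (hpow ▸ (hpP _).mpr (dvd_mul_right _ _))
    -- Here a = p c with p ∤ c by squarefreeness, so β divides c p with c a local unit; β^p - β is
    -- trivially in (p, β).
    refine isIntegrallyClosed_localization_of_locally_principal P β hβP
      (exists_dvd_mul_of_frobenius_fixed P hβ hp one_ne_zero hp' hβP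
      (Ideal.sub_mem _ (Ideal.pow_mem_of_mem _ (Ideal.subset_span (by simp)) _
        (pow_pos hp.pos _)) (Ideal.subset_span (by simp))) ⟨(c : R), ?_, ?_⟩)
    · rw [hpP]
      rintro ⟨d, rfl⟩
      exact hp.one_lt.ne' (by
        simpa [Int.isUnit_iff_natAbs_eq] using ha p ⟨d, by ring⟩)
    · have : β ∣ β ^ 60 := dvd_pow_self _ (by norm_num)
      rw [hpow, mul_comm] at this
      exact_mod_cast this
  · by_cases h2 : p = 2
    · subst h2
      refine isIntegrallyClosed_localization_of_pow_sub P hβ (N := 15) (e := 2) hp hpP hpow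
        (by norm_num) hpa ?_
      intro h
      have h0 : (((a - a ^ 2 ^ 2 : ℤ)) : ZMod 4) = 0 := (ZMod.intCast_zmod_eq_zero_iff_dvd _ 4).mpr h
      have h1 : ¬ (a : ZMod 4) = (1 : ℤ) := fun h => h4 ((ZMod.intCast_eq_intCast_iff _ _ 4).mp h)
      have h3 : ¬ (a : ZMod 4) = 0 := fun h => hpa
        (dvd_trans (by norm_num) ((ZMod.intCast_zmod_eq_zero_iff_dvd _ 4).mp h))
      push_cast at h0 h1
      generalize (a : ZMod 4) = x at h0 h1 h3
      revert x
      decide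
    by_cases h3 : p = 3
    · subst h3
      refine isIntegrallyClosed_localization_of_pow_sub P hβ (N := 20) (e := 1) hp hpP hpow
        (by norm_num) hpa ?_
      intro h
      have h0 : (((a - a ^ 3 ^ 1 : ℤ)) : ZMod 9) = 0 := (ZMod.intCast_zmod_eq_zero_iff_dvd _ 9).mpr h
      have h1 : ¬ (a : ZMod 9) = (1 : ℤ) := fun h => h9.1 ((ZMod.intCast_eq_intCast_iff _ _ 9).mp h)
      have h2 : ¬ (a : ZMod 9) = (-1 : ℤ) :=
        fun h => h9.2 ((ZMod.intCast_eq_intCast_iff _ _ 9).mp h)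
      have h3 : ¬ (a : ZMod 9) = 0 := fun h => hpa
        (dvd_trans (by norm_num) ((ZMod.intCast_zmod_eq_zero_iff_dvd _ 9).mp h))
      push_cast at h0 h1 h2
      generalize (a : ZMod 9) = x at h0 h1 h2 h3
      revert x
      decide
    by_cases h5 : p = 5
    · subst h5
      refine isIntegrallyClosed_localization_of_pow_sub P hβ (N := 12) (e := 1) hp hpP hpow
        (by norm_num) hpa ?_
      intro h
      have h0 : (((a - a ^ 5 ^ 1 : ℤ)) : ZMod 25) = 0 :=
        (ZMod.intCast_zmod_eq_zero_iff_dvd _ 25).mpr h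
      have hne : ∀ n : ℤ, ¬ a ≡ n [ZMOD 25] → ¬ (a : ZMod 25) = n :=
        fun n hn h => hn ((ZMod.intCast_eq_intCast_iff _ _ 25).mp h)
      have h1 := hne _ h25.1
      have h2 := hne _ h25.2.1
      have h3 := hne _ h25.2.2.1
      have h4 := hne _ h25.2.2.2
      have h5 : ¬ (5 * a : ZMod 25) = 0 := fun h => hpa (by
        have := (ZMod.intCast_zmod_eq_zero_iff_dvd (5 * a) 25).mp (by push_cast; exact h)
        omega)
      push_cast at h0 h1 h2 h3 h4
      generalize (a : ZMod 25) = x at h0 h1 h2 h3 h4 h5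
      -- The fourth roots of unity modulo 25 are ±1 and ±7: this is where the classes ±7 come from.
      have key : ∀ x : ZMod 25, x - x ^ 5 = 0 →
          x = 1 ∨ x = -1 ∨ x = 7 ∨ x = -7 ∨ 5 * x = 0 := by decide
      rcases key x (by simpa using h0) with h | h | h | h | h
      exacts [h1 (by simpa using h), h2 (by simpa using h), h3 (by simpa using h),
        h4 (by simpa using h), h5 h]
    have hp60 : ¬ p ∣ 60 := by
      intro h
      rw [show 60 = 2 ^ 2 * 3 * 5 by norm_num, hp.dvd_mul, hp.dvd_mul,
        Nat.prime_dvd_prime_iff_eq hp Nat.prime_five,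
        Nat.prime_dvd_prime_iff_eq hp Nat.prime_three] at h
      rcases h with (h | h) | h
      · exact h2 ((Nat.prime_dvd_prime_iff_eq hp Nat.prime_two).mp (hp.dvd_of_dvd_pow h))
      · exact h3 h
      · exact h5 h
    -- For p ∤ 60a the polynomial X^60 - a is separable modulo p, and p itself is the local
    -- generator.
    obtain ⟨k, hk, hfix⟩ := pow_frobenius_sub_mem (Ideal.span {(p : R), (p : R)}) hp
      (Ideal.subset_span (by simp)) (by rw [hpow, sub_self]; exact zero_mem _) hp60 hpa
    exact isIntegrallyClosed_localization_of_locally_principal P _ hp'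
      (exists_dvd_mul_of_frobenius_fixed P hβ hp hk hp' hp' hfix
        ⟨1, (Ideal.ne_top_iff_one P).mp hP.ne_top, by simp⟩)

/-- Clearing denominators shows that K is the fraction field of ℤ[b]; being integrally closed, ℤ[b]
then contains every algebraic integer of K. -/
theorem isMonogenicField_of_pow_sixty {K : Type*} [Field K] [CharZero K] {b : K} {a : ℤ}
    (ha : Squarefree a) (hpow : b ^ 60 = a) (htop : ℚ⟮b⟯ = ⊤) (h4 : ¬ a ≡ 1 [ZMOD 4])
    (h9 : ¬ a ≡ 1 [ZMOD 9] ∧ ¬ a ≡ -1 [ZMOD 9])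
    (h25 : ¬ a ≡ 1 [ZMOD 25] ∧ ¬ a ≡ -1 [ZMOD 25] ∧ ¬ a ≡ 7 [ZMOD 25] ∧ ¬ a ≡ -7 [ZMOD 25]) :
    IsMonogenicField K := by
  have hint : IsIntegral ℤ b := by
    apply IsIntegral.of_pow (n := 60) (by norm_num)
    rw [hpow]
    exact isIntegral_algebraMap (R := ℤ) (A := K) (x := a)
  let R := Algebra.adjoin ℤ {b}
  let β : R := ⟨b, Algebra.self_mem_adjoin_singleton ℤ b⟩
  have hβ : Algebra.adjoin ℤ {β} = ⊤ := by
    have := Algebra.adjoin_adjoin_coe_preimage (R := ℤ) (s := ({b} : Set K))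
    convert this using 2
    ext x
    simp [β, Subtype.ext_iff]
  have : Algebra.IsIntegral ℤ R := ⟨fun x => by
    rw [← isIntegral_algebraMap_iff (B := K) Subtype.val_injective]
    exact adjoin_le_integralClosure hint x.2⟩
  have : Algebra.FiniteType ℤ R := ⟨{β}, by simpa using hβ⟩
  have : IsNoetherianRing R := Algebra.FiniteType.isNoetherianRing ℤ R
  have hRic : IsIntegrallyClosed R := isIntegrallyClosed_of_pow_sixty hβ ha
    (Subtype.ext (by simpa [β] using hpow)) h4 h9 h25
  have hden : ∀ x : K, ∃ n : ℤ, n ≠ 0 ∧ (n : K) * x ∈ R := by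
    intro x
    have hx : x ∈ Algebra.adjoin ℚ {b} := by
      rw [← IntermediateField.adjoin_simple_toSubalgebra_of_isAlgebraic
        (hint.tower_top (A := ℚ)).isAlgebraic, htop]
      exact Algebra.mem_top
    induction hx using Algebra.adjoin_induction with
    | mem y hy => exact ⟨1, one_ne_zero, by 
        rw [Set.mem_singleton_iff.mp hy, Int.cast_one, one_mul]; exact β.2⟩
    | algebraMap q =>
      refine ⟨q.den, by exact_mod_cast q.den_nz, ?_⟩
      have : (((q.den : ℤ) : K)) * algebraMap ℚ K q = ((q.num : ℤ) : K) := by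
        rw [mul_comm, eq_ratCast]
        exact_mod_cast congrArg (Rat.cast : ℚ → K) (Rat.mul_den_eq_num q)
      rw [this]
      exact R.intCast_mem _
    | add x y _ _ hx hy =>
      obtain ⟨n, hn, hx⟩ := hx
      obtain ⟨m, hm, hy⟩ := hy
      refine ⟨n * m, mul_ne_zero hn hm, ?_⟩
      have := R.add_mem (R.mul_mem (R.intCast_mem m) hx) (R.mul_mem (R.intCast_mem n) hy)
      convert this using 1
      push_cast
      ring
    | mul x y _ _ hx hy =>
      obtain ⟨n, hn, hx⟩ := hx
      obtain ⟨m, hm, hy⟩ := hy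
      refine ⟨n * m, mul_ne_zero hn hm, ?_⟩
      convert R.mul_mem hx hy using 1
      push_cast
      ring
  have hfrac : IsFractionRing R K := by
    refine .of_field _ _ fun x => ?_
    obtain ⟨n, hn, hx⟩ := hden x
    refine ⟨⟨_, hx⟩, (n : R), ?_⟩
    have hn' : (n : K) ≠ 0 := by exact_mod_cast hn
    rw [map_intCast, eq_div_iff hn', mul_comm]
    rfl
  obtain ⟨θ, rfl⟩ : ∃ θ : NumberField.RingOfIntegers K, (θ : K) = b := ⟨⟨b, hint⟩, rfl⟩
  refine ⟨θ, htop, ?_⟩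
  rw [eq_top_iff]
  rintro x -
  have hx : IsIntegral R (x : K) := IsIntegral.tower_top (R := ℤ) x.2
  obtain ⟨y, hy⟩ := IsIntegrallyClosed.isIntegral_iff.mp hx
  let v : NumberField.RingOfIntegers K →ₐ[ℤ] K := Algebra.algHom ℤ _ K
  have hmap : (Algebra.adjoin ℤ {θ}).map v = R := by
    rw [AlgHom.map_adjoin, Set.image_singleton]
    rfl
  have hxR : (x : K) ∈ R := hy ▸ y.2
  rw [← hmap] at hxR
  obtain ⟨z, hz, hzx⟩ := hxR
  rwa [← NumberField.RingOfIntegers.coe_injective hzx]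

/-! ### Local models: Eisenstein extensions and Witt vectors -/

/-- Adjoining a root of an Eisenstein polynomial to a discrete valuation ring gives an integrally
closed domain with the same residue field, in which the root is a uniformizer. -/
theorem exists_eisenstein_extension {W k : Type} [CommRing W] [IsDomain W]
    [IsDiscreteValuationRing W] [Field k] (ρ : W →+* k) (hρ : Function.Surjective ρ) {ϖ : W}
    (hker : ∀ x, ρ x = 0 ↔ ϖ ∣ x) {E : W[X]} (hE : E.Monic) (hdeg : 0 < E.natDegree)
    (hmem : ∀ i < E.natDegree, ϖ ∣ E.coeff i) (h0 : ¬ ϖ ^ 2 ∣ E.coeff 0) :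
    ∃ (B : Type) (_ : CommRing B) (_ : IsDomain B) (_ : IsIntegrallyClosed B) (ι : W →+* B) (t : B)
      (σ : B →+* k), Function.Injective ι ∧ E.eval₂ ι t = 0 ∧ (∀ x, σ (ι x) = ρ x) ∧ σ t = 0 := by
  have hkerI : RingHom.ker ρ = Ideal.span {ϖ} := by
    ext x; rw [RingHom.mem_ker, hker, Ideal.mem_span_singleton]
  have hmax : RingHom.ker ρ = IsLocalRing.maximalIdeal W := IsLocalRing.ker_eq_maximalIdeal ρ hρ
  have hEis : E.IsEisensteinAt (RingHom.ker ρ) := by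
    refine ⟨?_, fun {n} hn => (hker _).mpr (hmem n hn), ?_⟩
    · rw [hE.leadingCoeff, RingHom.mem_ker, map_one]
      exact one_ne_zero
    · rwa [hkerI, Ideal.span_singleton_pow, Ideal.mem_span_singleton]
  have hirr : Irreducible E :=
    hEis.irreducible (RingHom.ker_isPrime ρ) hE.isPrimitive hdeg
  have hdom : IsDomain (AdjoinRoot E) := AdjoinRoot.isDomain_of_prime hirr.prime
  have : Module.Finite W (AdjoinRoot E) := hE.finite_adjoinRoot
  have : IsNoetherianRing (AdjoinRoot E) := Algebra.FiniteType.isNoetherianRing W _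
  have hρ0 : ρ (E.coeff 0) = 0 := (hker _).mpr (hmem 0 hdeg)
  let σ : AdjoinRoot E →+* k := AdjoinRoot.lift ρ 0 (by rw [eval₂_at_zero, hρ0])
  have hσof : ∀ x, σ (AdjoinRoot.of E x) = ρ x := fun x => AdjoinRoot.lift_of _
  have hσt : σ (AdjoinRoot.root E) = 0 := AdjoinRoot.lift_root _
  have hdecomp : ∀ f : W[X], AdjoinRoot.mk E f =
      AdjoinRoot.root E * AdjoinRoot.mk E f.divX + AdjoinRoot.of E (f.coeff 0) := by
    intro f
    conv_lhs => rw [← X_mul_divX_add f]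
    rw [map_add, map_mul, AdjoinRoot.mk_X, AdjoinRoot.mk_C]
  -- The constant term of E is ϖ times a unit, and the root divides every other term of E(root) = 0.
  have hϖ : AdjoinRoot.root E ∣ AdjoinRoot.of E ϖ := by
    obtain ⟨e, he⟩ := hmem 0 hdeg
    have heu : IsUnit e := by
      by_contra h
      have : e ∈ RingHom.ker ρ := hmax ▸ (IsLocalRing.mem_maximalIdeal e).mpr h
      obtain ⟨d, rfl⟩ := (hker e).mp this
      exact h0 ⟨d, by rw [he]; ring⟩
    have h1 := hdecomp E
    rw [AdjoinRoot.mk_self, he, map_mul] at h1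
    have h2 : AdjoinRoot.root E ∣ AdjoinRoot.of E ϖ * AdjoinRoot.of E e :=
      ⟨-AdjoinRoot.mk E E.divX, by linear_combination (-1 : AdjoinRoot E) * h1⟩
    exact (heu.map _).dvd_mul_right.mp h2
  have hkerσ : RingHom.ker σ = Ideal.span {AdjoinRoot.root E} := by
    apply le_antisymm
    · intro x hx
      obtain ⟨f, rfl⟩ := AdjoinRoot.mk_surjective x
      rw [RingHom.mem_ker, hdecomp, map_add, map_mul, hσt, zero_mul, zero_add, hσof, hker] at hx
      rw [hdecomp, Ideal.mem_span_singleton]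
      exact dvd_add (dvd_mul_right _ _) (hϖ.trans (map_dvd _ hx))
    · rw [Ideal.span_singleton_le_iff_mem]
      exact hσt
  have hσsurj : Function.Surjective σ := fun y => by
    obtain ⟨x, rfl⟩ := hρ y
    exact ⟨_, hσof x⟩
  have hσmax : (RingHom.ker σ).IsMaximal := RingHom.ker_isMaximal_of_surjective σ hσsurj
  -- A maximal ideal contracts to the one of W by integrality, so it contains the lower coefficients
  -- of E, hence a power of the root, hence the root.
  have hlocal : IsLocalRing (AdjoinRoot E) := by
    refine IsLocalRing.of_unique_max_ideal ⟨RingHom.ker σ, hσmax, fun M hM => ?_⟩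
    have hMc : M.comap (algebraMap W (AdjoinRoot E)) = RingHom.ker ρ := by
      rw [hmax]
      exact IsLocalRing.eq_maximalIdeal (Ideal.isMaximal_comap_of_isIntegral_of_isMaximal M)
    have hcoeff : ∀ i < E.natDegree, AdjoinRoot.of E (E.coeff i) ∈ M := fun i hi => by
      have : E.coeff i ∈ M.comap (algebraMap W (AdjoinRoot E)) :=
        hMc ▸ (hker _).mpr (hmem i hi)
      exact this
    have hroot : AdjoinRoot.root E ∈ M := by
      apply hM.isPrime.mem_of_pow_mem E.natDegree
      have h1 := AdjoinRoot.eval₂_root E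
      rw [eval₂_eq_sum_range, Finset.sum_range_succ, hE.coeff_natDegree, map_one, one_mul] at h1
      rw [eq_neg_of_add_eq_zero_right h1]
      exact M.neg_mem (M.sum_mem fun i hi =>
        M.mul_mem_right _ (hcoeff i (Finset.mem_range.mp hi)))
    refine (hσmax.eq_of_le hM.ne_top ?_).symm
    rw [hkerσ, Ideal.span_singleton_le_iff_mem]
    exact hroot
  have hprinc : (IsLocalRing.maximalIdeal (AdjoinRoot E)).IsPrincipal :=
    ⟨_, (IsLocalRing.eq_maximalIdeal hσmax).symm.trans hkerσ⟩
  have hiff := (tfae_of_isNoetherianRing_of_isLocalRing_of_isDomain (AdjoinRoot E)).out 4 3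
  refine ⟨AdjoinRoot E, inferInstance, hdom, (hiff.mp hprinc).1, AdjoinRoot.of E,
    AdjoinRoot.root E, σ, ?_, AdjoinRoot.eval₂_root E, hσof, hσt⟩
  exact AdjoinRoot.of.injective_of_degree_ne_zero (natDegree_pos_iff_degree_pos.mp hdeg).ne'

section Witt

variable {p : ℕ} [Fact p.Prime] {k : Type} [Field k] [CharP k p] [PerfectRing k p]

lemma WittVector.constantCoeff_eq_zero_iff (x : WittVector p k) :
    WittVector.constantCoeff x = 0 ↔ (p : WittVector p k) ∣ x := by
  rw [← RingHom.mem_ker, WittVector.ker_constantCoeff, Ideal.mem_span_singleton]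

lemma WittVector.exists_root {f : (WittVector p k)[X]} (hf : f.Monic) {b : k}
    (h0 : f.eval₂ WittVector.constantCoeff b = 0)
    (h1 : (derivative f).eval₂ WittVector.constantCoeff b ≠ 0) :
    ∃ x : WittVector p k, f.eval x = 0 ∧ WittVector.constantCoeff x = b := by
  obtain ⟨x₀, rfl⟩ := WittVector.constantCoeff_surjective p b
  rw [eval₂_at_apply] at h0 h1
  have hmem : ∀ x : WittVector p k, x ∈ Ideal.span {(p : WittVector p k)} ↔
      WittVector.constantCoeff x = 0 := fun x => by
    rw [WittVector.constantCoeff_eq_zero_iff, Ideal.mem_span_singleton]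
  have hu : IsUnit ((derivative f).eval x₀) := by
    have := WittVector.isUnit_of_coeff_zero_ne_zero ((derivative f).eval x₀) h1
    exact this
  obtain ⟨x, hx, hxx⟩ := HenselianRing.is_henselian (I := Ideal.span {(p : WittVector p k)}) f hf x₀
    ((hmem _).mpr h0) (hu.map _)
  refine ⟨x, hx, ?_⟩
  rw [hmem, map_sub, sub_eq_zero] at hxx
  exact hxx

lemma WittVector.exists_pow_eq {n : ℕ} (hn : (n : k) ≠ 0) {s : WittVector p k} {b : k}
    (hb : b ≠ 0) (hs : WittVector.constantCoeff s = b ^ n) :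
    ∃ x : WittVector p k, x ^ n = s ∧ WittVector.constantCoeff x = b := by
  have hn0 : n ≠ 0 := by rintro rfl; simp at hn
  obtain ⟨x, hx, hxb⟩ := WittVector.exists_root (f := X ^ n - C s) (b := b)
    (monic_X_pow_sub_C s hn0) (by simp [hs]) (by simp [derivative_X_pow, hn, hb])
  exact ⟨x, by simpa [sub_eq_zero] using hx, hxb⟩

instance WittVector.charZero_of_perfect : CharZero (WittVector p k) := by
  refine charZero_of_inj_zero fun n hn => ?_
  by_contra hn0
  obtain ⟨m, d, hd, rfl⟩ := Nat.exists_eq_pow_mul_and_not_dvd hn0 p (Fact.out : p.Prime).ne_one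
  push_cast at hn
  rcases mul_eq_zero.mp hn with h | h
  · exact WittVector.p_nonzero p k (eq_zero_of_pow_eq_zero h)
  · have := congrArg WittVector.constantCoeff h
    rw [map_natCast, map_zero, CharP.cast_eq_zero_iff k p] at this
    exact hd this

end Witt

/-! ### Homomorphisms from the ring of integers to finite fields -/

/-- A root τ of the minimal polynomial of b embeds K in the fraction field of B; integral elements
land in B because B is integrally closed. -/
lemma exists_ringOfIntegers_hom {K : Type*} [Field K] [CharZero K] {b : K} {a : ℤ}
    (hmin : minpoly ℚ b = X ^ 60 - C (a : ℚ)) (htop : ℚ⟮b⟯ = ⊤) {B : Type*} [CommRing B]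
    [IsDomain B] [IsIntegrallyClosed B] [CharZero B] {τ : B} (hτ : τ ^ 60 = a) :
    ∃ f : NumberField.RingOfIntegers K →+* B,
      ∀ x : NumberField.RingOfIntegers K, (x : K) = b → f x = τ := by
  have hint : IsIntegral ℚ b := by
    by_contra h
    rw [minpoly.eq_zero h] at hmin
    exact (monic_X_pow_sub_C (a : ℚ) (n := 60) (by norm_num)).ne_zero hmin.symm
  have hadj : Algebra.adjoin ℚ {b} = ⊤ := by
    rw [← IntermediateField.adjoin_simple_toSubalgebra_of_isAlgebraic hint.isAlgebraic, htop]
    rfl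
  let L := FractionRing B
  have : CharZero L := charZero_of_injective_algebraMap (FaithfulSMul.algebraMap_injective B L)
  let pb := PowerBasis.ofAdjoinEqTop hint hadj
  have hgen : pb.gen = b := PowerBasis.ofAdjoinEqTop_gen _ _
  have hroot : aeval (algebraMap B L τ) (minpoly ℚ pb.gen) = 0 := by
    rw [hgen, hmin, map_sub, map_pow, aeval_X, ← map_pow, hτ]
    simp
  let g : K →ₐ[ℚ] L := pb.lift (algebraMap B L τ) hroot
  have hgb : g b = algebraMap B L τ := by
    have := pb.lift_gen (algebraMap B L τ) hroot
    rwa [hgen] at this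
  let g' : NumberField.RingOfIntegers K →+* L := (g : K →+* L).comp (algebraMap _ K)
  have hrange : ∀ x, g' x ∈ (algebraMap B L).range := fun x => by
    obtain ⟨q, hq, hqx⟩ := x.2
    have h1 : IsIntegral B (g' x) := by
      refine ⟨q.map (Int.castRingHom B), hq.map _, ?_⟩
      have h2 := congrArg (g : K →+* L) hqx
      rw [hom_eval₂, map_zero] at h2
      rw [eval₂_map, ← h2]
      exact congrArg (fun φ => q.eval₂ φ (g' x)) (RingHom.ext_int _ _)
    exact IsIntegrallyClosed.isIntegral_iff.mp h1
  let e : B ≃+* (algebraMap B L).range :=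
    RingEquiv.ofBijective (algebraMap B L).rangeRestrict
      ⟨fun x y h => FaithfulSMul.algebraMap_injective B L (congrArg Subtype.val h),
        (algebraMap B L).rangeRestrict_surjective⟩
  refine ⟨(e.symm : _ →+* B).comp (g'.codRestrict _ hrange), fun x hx => ?_⟩
  rw [RingHom.comp_apply]
  apply e.injective
  simp only [RingHom.coe_coe, RingEquiv.apply_symm_apply]
  apply Subtype.ext
  change g (x : K) = algebraMap B L τ
  rw [hx, hgb]

lemma exists_residue_hom {K : Type*} [Field K] [CharZero K] {b : K} {a : ℤ}
    (hmin : minpoly ℚ b = X ^ 60 - C (a : ℚ)) (htop : ℚ⟮b⟯ = ⊤) {B k : Type*} [CommRing B]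
    [IsDomain B] [IsIntegrallyClosed B] [CharZero B] [Field k] {β η : NumberField.RingOfIntegers K}
    (hβ : (β : K) = b) (σ : B →+* k) {τ y : B} (hτ : τ ^ 60 = a)
    (hy : ∀ f : NumberField.RingOfIntegers K →+* B, f β = τ → f η = y) :
    ∃ f : NumberField.RingOfIntegers K →+* k, f β = σ τ ∧ f η = σ y := by
  obtain ⟨f, hf⟩ := exists_ringOfIntegers_hom hmin htop hτ
  exact ⟨σ.comp f, by simp [hf β hβ], by simp [hy f (hf β hβ)]⟩

/-- The equation reads z + 3z² + 3z³ = c, which is not monic. Substituting z = c/x gives x³ - x² -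
3cx - 3c² = 0, monic with simple root 1 modulo 3, so Hensel's lemma applies. -/
lemma WittVector.exists_cube_root [Fact (Nat.Prime 3)] {k : Type} [Field k] [CharP k 3]
    [PerfectRing k 3] (c : ℤ) :
    ∃ z : WittVector 3 k, (1 + 3 * z) ^ 3 = 1 + 9 * (c : WittVector 3 k) := by
  have h3 : (3 : k) = 0 := by exact_mod_cast CharP.cast_eq_zero k 3
  obtain ⟨C₀, hC₀⟩ : ∃ C₀ : WittVector 3 k, C₀ = c := ⟨_, rfl⟩
  obtain ⟨d, hd⟩ : ∃ d, d = 3 * C₀ := ⟨_, rfl⟩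
  obtain ⟨e, he⟩ : ∃ e, e = 3 * C₀ ^ 2 := ⟨_, rfl⟩
  have hd' : WittVector.constantCoeff d = 0 := by rw [hd, map_mul, map_ofNat, h3, zero_mul]
  have he' : WittVector.constantCoeff e = 0 := by rw [he, map_mul, map_ofNat, h3, zero_mul]
  obtain ⟨x, hx, hx1⟩ := WittVector.exists_root (p := 3) (k := k) (b := 1)
    (f := X ^ 3 - X ^ 2 - C d * X - C e) (by monicity!)
    (by simp [-WittVector.constantCoeff_apply, hd', he'])
    (by
      simp [-WittVector.constantCoeff_apply, hd', map_ofNat WittVector.constantCoeff, eval₂_add, eval₂_sub, eval₂_mul]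
      intro h
      exact (one_ne_zero : (1 : k) ≠ 0) (by linear_combination h))
  have hu : IsUnit x := WittVector.isUnit_of_coeff_zero_ne_zero x (by
    change WittVector.constantCoeff x ≠ 0
    rw [hx1]
    exact one_ne_zero)
  obtain ⟨v, hv⟩ := hu.exists_right_inv
  simp only [eval_sub, eval_pow, eval_X, eval_mul, eval_C, hd, he] at hx
  refine ⟨C₀ * v, ?_⟩
  rw [← hC₀]
  have h1 : (x * v) ^ 3 = 1 := by rw [hv, one_pow]
  have h2 : (1 + 3 * (C₀ * v)) * x = x + 3 * C₀ := by linear_combination 3 * C₀ * hv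
  have h4 : ((1 + 3 * (C₀ * v)) * x) ^ 3 = (1 + 9 * C₀) * x ^ 3 := by
    rw [h2]
    linear_combination (-9 * C₀) * hx
  apply (hu.pow 3).mul_right_cancel
  rw [← mul_pow, h4]

/-- The substitution z = c/x again makes the equation monic, with simple root 1 modulo 5. -/
lemma WittVector.exists_fifth_root [Fact (Nat.Prime 5)] {k : Type} [Field k] [CharP k 5]
    [PerfectRing k 5] (c : ℤ) :
    ∃ z : WittVector 5 k, (1 + 5 * z) ^ 5 = 1 + 25 * (c : WittVector 5 k) := by
  have h5 : (5 : k) = 0 := by exact_mod_cast CharP.cast_eq_zero k 5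
  obtain ⟨C₀, hC₀⟩ : ∃ C₀ : WittVector 5 k, C₀ = c := ⟨_, rfl⟩
  obtain ⟨d, hd⟩ : ∃ d, d = 5 * (2 * C₀) := ⟨_, rfl⟩
  obtain ⟨e, he⟩ : ∃ e, e = 5 * (10 * C₀ ^ 2) := ⟨_, rfl⟩
  obtain ⟨g, hg⟩ : ∃ g, g = 5 * (25 * C₀ ^ 3) := ⟨_, rfl⟩
  obtain ⟨j, hj⟩ : ∃ j, j = 5 * (25 * C₀ ^ 4) := ⟨_, rfl⟩
  have hd' : WittVector.constantCoeff d = 0 := by rw [hd, map_mul, map_ofNat, h5, zero_mul]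
  have he' : WittVector.constantCoeff e = 0 := by rw [he, map_mul, map_ofNat, h5, zero_mul]
  have hg' : WittVector.constantCoeff g = 0 := by rw [hg, map_mul, map_ofNat, h5, zero_mul]
  have hj' : WittVector.constantCoeff j = 0 := by rw [hj, map_mul, map_ofNat, h5, zero_mul]
  obtain ⟨x, hx, hx1⟩ := WittVector.exists_root (p := 5) (k := k) (b := 1)
    (f := X ^ 5 - X ^ 4 - C d * X ^ 3 - C e * X ^ 2 - C g * X - C j) (by monicity!)
    (by simp [-WittVector.constantCoeff_apply, hd', he', hg', hj'])
    (by
      simp [-WittVector.constantCoeff_apply, hd', he', hg', map_ofNat WittVector.constantCoeff, eval₂_add, eval₂_sub, eval₂_mul]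
      intro h
      exact (one_ne_zero : (1 : k) ≠ 0) (by linear_combination h))
  have hu : IsUnit x := WittVector.isUnit_of_coeff_zero_ne_zero x (by
    change WittVector.constantCoeff x ≠ 0
    rw [hx1]
    exact one_ne_zero)
  obtain ⟨v, hv⟩ := hu.exists_right_inv
  simp only [eval_sub, eval_pow, eval_X, eval_mul, eval_C, hd, he, hg, hj] at hx
  refine ⟨C₀ * v, ?_⟩
  rw [← hC₀]
  have h2 : (1 + 5 * (C₀ * v)) * x = x + 5 * C₀ := by linear_combination 5 * C₀ * hv
  have h4 : ((1 + 5 * (C₀ * v)) * x) ^ 5 = (1 + 25 * C₀) * x ^ 5 := by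
    rw [h2]
    linear_combination (-25 * C₀) * hx
  apply (hu.pow 5).mul_right_cancel
  rw [← mul_pow, h4]

lemma WittVector.not_sq_dvd (p : ℕ) [Fact p.Prime] {k : Type} [Field k] [CharP k p]
    [PerfectRing k p] : ¬ (p : WittVector p k) ^ 2 ∣ p := by
  rw [sq]
  intro h
  have h1 := (mul_dvd_mul_iff_left (WittVector.p_nonzero p k)).mp
    (h.trans (mul_one (p : WittVector p k)).symm.dvd)
  exact (WittVector.irreducible p).not_isUnit (isUnit_of_dvd_one h1)

/-- The image of D = ε β^20 is a cube root of 1 + 9c, so it is 1 + 3z times a cube root of unity.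
The trivial one gives η ↦ 1, a primitive one gives η ↦ 0. -/
theorem exists_residue_hom_three {K : Type*} [Field K] [CharZero K] {b : K} {a : ℤ}
    (hmin : minpoly ℚ b = X ^ 60 - C (a : ℚ)) (htop : ℚ⟮b⟯ = ⊤)
    {k : Type} [Field k] [CharP k 3] [PerfectRing k 3] {β η : NumberField.RingOfIntegers K}
    (hβ : (β : K) = b) {ε c : ℤ} (hε : ε ^ 2 = 1) (ha : ε * a = 1 + 9 * c)
    (hη : 3 * η = 1 + ε * β ^ 20 + (ε * β ^ 20) ^ 2) {b₀ h : k} (hb₀ : b₀ ^ 20 = ε)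
    (hh : h = 0 ∨ h = 1) :
    ∃ f : NumberField.RingOfIntegers K →+* k, f β = b₀ ∧ f η = h := by
  have : Fact (Nat.Prime 3) := ⟨Nat.prime_three⟩
  have h3 : (3 : k) = 0 := by exact_mod_cast CharP.cast_eq_zero k 3
  have hεk : (ε : k) ^ 2 = 1 := by exact_mod_cast congrArg (Int.cast : ℤ → k) hε
  have hb₀0 : b₀ ≠ 0 := by
    rintro rfl
    rw [zero_pow (by norm_num)] at hb₀
    rw [← hb₀] at hεk
    simp at hεk
  obtain ⟨z, hz⟩ := WittVector.exists_cube_root (k := k) c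
  obtain ⟨τ₀, hτ₀, hτ₀b⟩ := WittVector.exists_pow_eq (p := 3) (n := 20) (b := b₀)
    (s := (ε : WittVector 3 k) * (1 + 3 * z)) (by
      intro h20
      push_cast at h20
      exact (one_ne_zero : (1 : k) ≠ 0) (by linear_combination 7 * h3 - h20)) hb₀0 (by
      rw [hb₀, map_mul, map_intCast, map_add, map_mul, map_ofNat, h3, zero_mul, map_one, add_zero,
        mul_one])
  have hεR : ∀ {R : Type} [CommRing R], (ε : R) ^ 2 = 1 :=
    fun {R} _ => by exact_mod_cast congrArg (Int.cast : ℤ → R) hε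
  have haR : ∀ {R : Type} [CommRing R], (ε : R) * a = 1 + 9 * c :=
    fun {R} _ => by exact_mod_cast congrArg (Int.cast : ℤ → R) ha
  have hW60 : τ₀ ^ 60 = a := by
    rw [show 60 = 20 * 3 by norm_num, pow_mul, hτ₀, mul_pow, hz, ← haR]
    linear_combination ((a : WittVector 3 k) * (ε ^ 2 + 1)) * hεR (R := WittVector 3 k)
  have hfη : ∀ {B : Type} [CommRing B] [IsDomain B] [CharZero B] {τ y : B},
      3 * y = 1 + ε * τ ^ 20 + (ε * τ ^ 20) ^ 2 →
      ∀ f : NumberField.RingOfIntegers K →+* B, f β = τ → f η = y := by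
    intro B _ _ _ τ y hy f hf
    have h1 := congrArg f hη
    simp only [map_mul, map_add, map_pow, map_one, map_ofNat, map_intCast, hf] at h1
    exact mul_left_cancel₀ (by norm_num : (3 : B) ≠ 0) (h1.trans hy.symm)
  have hE2 : (X ^ 2 + C 3 * X + C 3 : (WittVector 3 k)[X]).natDegree = 2 := by compute_degree!
  rcases hh with rfl | rfl
  -- The Eisenstein polynomial is Φ₃(1 + X), so ζ = 1 + t is a primitive cube root of unity reducing
  -- to 1.
  · obtain ⟨B, _, _, _, ι, t, σ, hι, ht, hσ, hσt⟩ := exists_eisenstein_extension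
      (WittVector.constantCoeff : WittVector 3 k →+* k) (WittVector.constantCoeff_surjective 3)
      WittVector.constantCoeff_eq_zero_iff (E := X ^ 2 + C 3 * X + C 3) (by monicity!)
      (by rw [hE2]; norm_num) (by
        rw [hE2]
        intro i hi
        interval_cases i
        · simp
        · simp) (by simpa [coeff_X] using WittVector.not_sq_dvd 3)
    have : CharZero B := charZero_of_injective_ringHom hι
    have hζ : (1 + t) ^ 2 + (1 + t) + 1 = 0 := by
      simp [eval₂_add, eval₂_mul, map_ofNat ι] at ht
      linear_combination ht
    obtain ⟨ζ, hζt⟩ : ∃ ζ, ζ = 1 + t := ⟨_, rfl⟩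
    rw [← hζt] at hζ
    have hσζ : σ ζ = 1 := by rw [hζt, map_add, map_one, hσt, add_zero]
    have hζ3 : ζ ^ 3 = 1 := by linear_combination (ζ - 1) * hζ
    have hD : (ε : B) * (ζ * ι τ₀) ^ 20 = ζ ^ 2 * (1 + 3 * ι z) := by
      rw [mul_pow, ← map_pow, hτ₀, show 20 = 3 * 6 + 2 by norm_num, pow_add, pow_mul, hζ3]
      simp only [map_mul, map_add, map_one, map_ofNat, map_intCast, one_pow, one_mul]
      linear_combination (ζ ^ 2 * (1 + 3 * ι z)) * hεR (R := B)
    -- The witness y is (1 + D + D²)/3 for D = ζ²(1 + 3z), simplified by 1 + ζ + ζ² = 0; it reduces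
    -- to 3z = 0.
    obtain ⟨f, hf, hfe⟩ := exists_residue_hom hmin htop hβ σ (τ := ζ * ι τ₀)
      (by rw [mul_pow, ← map_pow, hW60, show 60 = 3 * 20 by norm_num, pow_mul, hζ3, map_intCast,
        one_pow, one_mul])
      (y := ι z * (ζ ^ 2 + 2 * ζ) + 3 * ζ * ι z ^ 2)
      (hfη (by
        rw [hD]
        linear_combination (-1 : B) * hζ - ζ * (1 + 3 * ι z) ^ 2 * hζ3))
    refine ⟨f, ?_, hfe.trans ?_⟩
    · rw [hf, map_mul, hσζ, hσ, hτ₀b, one_mul]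
    · simp only [map_add, map_mul, map_pow, map_ofNat, hσζ]
      linear_combination (σ (ι z) + σ (ι z) ^ 2) * h3
  · obtain ⟨f, hf, hfe⟩ := exists_residue_hom hmin htop hβ
      (WittVector.constantCoeff : WittVector 3 k →+* k) hW60 (y := 1 + 3 * z + 3 * z ^ 2)
      (hfη (by
        rw [hτ₀]
        linear_combination (-(1 + 3 * z) - (ε ^ 2 + 1) * (1 + 3 * z) ^ 2) *
          hεR (R := WittVector 3 k)))
    refine ⟨f, hf.trans hτ₀b, hfe.trans ?_⟩
    simp only [map_add, map_mul, map_one, map_ofNat, h3, zero_mul, add_zero]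

/-- As at 3, with fifth roots of unity: the Eisenstein polynomial is now Φ₅(1 + X). -/
theorem exists_residue_hom_five {K : Type*} [Field K] [CharZero K] {b : K} {a : ℤ}
    (hmin : minpoly ℚ b = X ^ 60 - C (a : ℚ)) (htop : ℚ⟮b⟯ = ⊤)
    {k : Type} [Field k] [CharP k 5] [PerfectRing k 5] {β η : NumberField.RingOfIntegers K}
    (hβ : (β : K) = b) {ε c : ℤ} (hε : ε ^ 2 = 1) (ha : ε * a = 1 + 25 * c)
    (hη : 5 * η = 1 + ε * β ^ 12 + (ε * β ^ 12) ^ 2 + (ε * β ^ 12) ^ 3 + (ε * β ^ 12) ^ 4)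
    {b₀ h : k} (hb₀ : b₀ ^ 12 = ε) (hh : h = 0 ∨ h = 1) :
    ∃ f : NumberField.RingOfIntegers K →+* k, f β = b₀ ∧ f η = h := by
  have : Fact (Nat.Prime 5) := ⟨Nat.prime_five⟩
  have h5 : (5 : k) = 0 := by exact_mod_cast CharP.cast_eq_zero k 5
  have hεk : (ε : k) ^ 2 = 1 := by exact_mod_cast congrArg (Int.cast : ℤ → k) hε
  have hb₀0 : b₀ ≠ 0 := by
    rintro rfl
    rw [zero_pow (by norm_num)] at hb₀
    rw [← hb₀] at hεk
    simp at hεk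
  obtain ⟨z, hz⟩ := WittVector.exists_fifth_root (k := k) c
  obtain ⟨τ₀, hτ₀, hτ₀b⟩ := WittVector.exists_pow_eq (p := 5) (n := 12) (b := b₀)
    (s := (ε : WittVector 5 k) * (1 + 5 * z)) (by
      intro h12
      push_cast at h12
      exact (one_ne_zero : (1 : k) ≠ 0) (by linear_combination 5 * h5 - 2 * h12)) hb₀0 (by
      rw [hb₀, map_mul, map_intCast, map_add, map_mul, map_ofNat, h5, zero_mul, map_one, add_zero,
        mul_one])
  have hεR : ∀ {R : Type} [CommRing R], (ε : R) ^ 2 = 1 :=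
    fun {R} _ => by exact_mod_cast congrArg (Int.cast : ℤ → R) hε
  have haR : ∀ {R : Type} [CommRing R], (ε : R) * a = 1 + 25 * c :=
    fun {R} _ => by exact_mod_cast congrArg (Int.cast : ℤ → R) ha
  have hW60 : τ₀ ^ 60 = a := by
    rw [show 60 = 12 * 5 by norm_num, pow_mul, hτ₀, mul_pow, hz, ← haR]
    linear_combination ((a : WittVector 5 k) * (ε ^ 4 + ε ^ 2 + 1)) * hεR (R := WittVector 5 k)
  have hfη : ∀ {B : Type} [CommRing B] [IsDomain B] [CharZero B] {τ y : B},
      5 * y = 1 + ε * τ ^ 12 + (ε * τ ^ 12) ^ 2 + (ε * τ ^ 12) ^ 3 + (ε * τ ^ 12) ^ 4 →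
      ∀ f : NumberField.RingOfIntegers K →+* B, f β = τ → f η = y := by
    intro B _ _ _ τ y hy f hf
    have h1 := congrArg f hη
    simp only [map_mul, map_add, map_pow, map_one, map_ofNat, map_intCast, hf] at h1
    exact mul_left_cancel₀ (by norm_num : (5 : B) ≠ 0) (h1.trans hy.symm)
  have hE4 : (X ^ 4 + C 5 * X ^ 3 + C 10 * X ^ 2 + C 10 * X + C 5 : (WittVector 5 k)[X]).natDegree
      = 4 := by compute_degree!
  rcases hh with rfl | rfl
  · have h10 : (5 : WittVector 5 k) ∣ 10 := ⟨2, by norm_num⟩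
    obtain ⟨B, _, _, _, ι, t, σ, hι, ht, hσ, hσt⟩ := exists_eisenstein_extension
      (WittVector.constantCoeff : WittVector 5 k →+* k) (WittVector.constantCoeff_surjective 5)
      WittVector.constantCoeff_eq_zero_iff
      (E := X ^ 4 + C 5 * X ^ 3 + C 10 * X ^ 2 + C 10 * X + C 5) (by monicity!)
      (by rw [hE4]; norm_num) (by
        rw [hE4]
        intro i hi
        interval_cases i
        · simp
        · simpa [coeff_X, coeff_X_pow] using h10
        · simpa [coeff_X, coeff_X_pow] using h10
        · simp) (by simpa using WittVector.not_sq_dvd 5)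
    have : CharZero B := charZero_of_injective_ringHom hι
    have hζ : (1 + t) ^ 4 + (1 + t) ^ 3 + (1 + t) ^ 2 + (1 + t) + 1 = 0 := by
      simp [eval₂_add, eval₂_mul, map_ofNat ι] at ht
      linear_combination ht
    obtain ⟨ζ, hζt⟩ : ∃ ζ, ζ = 1 + t := ⟨_, rfl⟩
    rw [← hζt] at hζ
    have hσζ : σ ζ = 1 := by rw [hζt, map_add, map_one, hσt, add_zero]
    have hζ5 : ζ ^ 5 = 1 := by linear_combination (ζ - 1) * hζ
    have hD : (ε : B) * (ζ * ι τ₀) ^ 12 = ζ ^ 2 * (1 + 5 * ι z) := by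
      rw [mul_pow, ← map_pow, hτ₀, show 12 = 5 * 2 + 2 by norm_num, pow_add, pow_mul, hζ5]
      simp only [map_mul, map_add, map_one, map_ofNat, map_intCast, one_pow, one_mul]
      linear_combination (ζ ^ 2 * (1 + 5 * ι z)) * hεR (R := B)
    obtain ⟨f, hf, hfe⟩ := exists_residue_hom hmin htop hβ σ (τ := ζ * ι τ₀)
      (by rw [mul_pow, ← map_pow, hW60, show 60 = 5 * 12 by norm_num, pow_mul, hζ5, map_intCast,
        one_pow, one_mul])
      (y := ζ ^ 2 * ι z + ζ ^ 4 * (2 * ι z + 5 * ι z ^ 2) +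
        ζ * (3 * ι z + 15 * ι z ^ 2 + 25 * ι z ^ 3) +
        ζ ^ 3 * (4 * ι z + 30 * ι z ^ 2 + 100 * ι z ^ 3 + 125 * ι z ^ 4))
      (hfη (by
        rw [hD]
        linear_combination (-1 : B) * hζ - ζ * (1 + 5 * ι z) ^ 3 * hζ5 -
          ζ ^ 3 * (1 + 5 * ι z) ^ 4 * hζ5))
    refine ⟨f, ?_, hfe.trans ?_⟩
    · rw [hf, map_mul, hσζ, hσ, hτ₀b, one_mul]
    · simp only [map_add, map_mul, map_pow, map_ofNat, hσζ]
      linear_combination (2 * σ (ι z) + 10 * σ (ι z) ^ 2 + 25 * σ (ι z) ^ 3 +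
        25 * σ (ι z) ^ 4) * h5
  · obtain ⟨f, hf, hfe⟩ := exists_residue_hom hmin htop hβ
      (WittVector.constantCoeff : WittVector 5 k →+* k) hW60
      (y := 1 + 5 * (2 * z) + 5 * (10 * z ^ 2) + 5 * (25 * z ^ 3) + 5 * (25 * z ^ 4))
      (hfη (by
        rw [hτ₀]
        linear_combination (-(1 + 5 * z) - (ε ^ 2 + 1) * (1 + 5 * z) ^ 2 -
          (ε ^ 4 + ε ^ 2 + 1) * (1 + 5 * z) ^ 3 -
          (ε ^ 6 + ε ^ 4 + ε ^ 2 + 1) * (1 + 5 * z) ^ 4) * hεR (R := WittVector 5 k)))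
    refine ⟨f, hf.trans hτ₀b, hfe.trans ?_⟩
    simp only [map_add, map_mul, map_one, map_ofNat, h5, zero_mul, add_zero]

/-- The value of η selects the square root 1 + 2y of `a` that β^30 must equal. Writing it as (1 +
2x)^15 reduces the problem to a square root of 1 + 2x, times a fifteenth root of unity ρ that
adjusts the residue of β. -/
theorem exists_residue_hom_two {K : Type*} [Field K] [CharZero K] {b : K} {a : ℤ}
    (hmin : minpoly ℚ b = X ^ 60 - C (a : ℚ)) (htop : ℚ⟮b⟯ = ⊤)
    {k : Type} [Field k] [CharP k 2] [PerfectRing k 2] {β η : NumberField.RingOfIntegers K}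
    (hβ : (β : K) = b) {c : ℤ} (ha : a = 1 + 4 * c) (hη : 2 * η + 1 = β ^ 30)
    {b₀ h ω : k} (hb₀ : b₀ ^ 15 = 1) (hω : ω ^ 2 + ω = 1) (hh : h ^ 2 + h = c) :
    ∃ f : NumberField.RingOfIntegers K →+* k, f β = b₀ ∧ f η = h := by
  have h2 : (2 : k) = 0 := by exact_mod_cast CharP.cast_eq_zero k 2
  have hb₀0 : b₀ ≠ 0 := by rintro rfl; simp at hb₀
  have haR : ∀ {R : Type} [CommRing R], (a : R) = 1 + 4 * c :=
    fun {R} _ => by exact_mod_cast congrArg (Int.cast : ℤ → R) ha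
  have hfη : ∀ {B : Type} [CommRing B] [IsDomain B] [CharZero B] {τ y : B},
      2 * y + 1 = τ ^ 30 →
      ∀ f : NumberField.RingOfIntegers K →+* B, f β = τ → f η = y := by
    intro B _ _ _ τ y hy f hf
    have h1 := congrArg f hη
    simp only [map_mul, map_add, map_pow, map_one, map_ofNat, hf] at h1
    exact mul_left_cancel₀ (by norm_num : (2 : B) ≠ 0) (add_right_cancel (h1.trans hy.symm))
  -- square roots of `a` that are fifteenth powers
  have hsqrt : ∀ {F : Type} [Field F] [CharP F 2] [PerfectRing F 2] (h : F), h ^ 2 + h = c →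
      ∃ y x : WittVector 2 F, (1 + 2 * x) ^ 15 = 1 + 2 * y ∧ (1 + 2 * y) ^ 2 = a ∧
        WittVector.constantCoeff y = h ∧ WittVector.constantCoeff x = h := by
    intro F _ _ _ h hh
    have h2 : (2 : F) = 0 := by exact_mod_cast CharP.cast_eq_zero F 2
    obtain ⟨C₀, hC₀⟩ : ∃ C₀ : WittVector 2 F, C₀ = c := ⟨_, rfl⟩
    have hC₀' : WittVector.constantCoeff C₀ = (c : F) := by rw [hC₀, map_intCast]
    obtain ⟨y, hy, hyh⟩ := WittVector.exists_root (p := 2) (k := F) (b := h)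
      (f := X ^ 2 + X - C C₀) (by monicity!)
      (by simp [-WittVector.constantCoeff_apply, hC₀', hh])
      (by
        simp [-WittVector.constantCoeff_apply, eval₂_add, eval₂_mul]
        intro hd
        exact (one_ne_zero : (1 : F) ≠ 0) (by linear_combination hd - h * h2))
    simp only [eval_sub, eval_add, eval_pow, eval_X, eval_C] at hy
    obtain ⟨r, hr, hr1⟩ := WittVector.exists_pow_eq (p := 2) (n := 15) (b := (1 : F))
      (s := 1 + 2 * y) (by
        intro h15
        push_cast at h15
        exact (one_ne_zero : (1 : F) ≠ 0) (by linear_combination h15 - 7 * h2)) one_ne_zero (by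
        rw [map_add, map_mul, map_ofNat, h2, zero_mul, map_one, add_zero, one_pow])
    obtain ⟨x, hx⟩ : ((2 : ℕ) : WittVector 2 F) ∣ r - 1 := by
      rw [← WittVector.constantCoeff_eq_zero_iff, map_sub, hr1, map_one, sub_self]
    push_cast at hx
    obtain rfl : r = 1 + 2 * x := by linear_combination hx
    refine ⟨y, x, hr, ?_, hyh, ?_⟩
    · rw [haR, ← hC₀]
      linear_combination 4 * hy
    -- The geometric sum gives y = x · Σ(1 + 2x)^i, and the sum is 15 ≡ 1 modulo 2, so x and y have
    -- the same residue.
    · have h1 := geom_sum_mul (1 + 2 * x) 15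
      rw [hr] at h1
      have h3 : (∑ i ∈ Finset.range 15, (1 + 2 * x) ^ i) * x = y :=
        mul_left_cancel₀ (two_ne_zero : (2 : WittVector 2 F) ≠ 0) (by linear_combination h1)
      have h4 := congrArg WittVector.constantCoeff h3
      rw [map_mul, map_sum] at h4
      simp only [map_pow, hr1, one_pow, hyh, Finset.sum_const, Finset.card_range,
        nsmul_eq_mul] at h4
      push_cast at h4
      linear_combination h4 - 7 * WittVector.constantCoeff x * h2
  obtain ⟨ρ, hρ, hρb⟩ := WittVector.exists_pow_eq (p := 2) (n := 15) (b := b₀) (s := 1) (by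
    intro h15
    push_cast at h15
    exact (one_ne_zero : (1 : k) ≠ 0) (by linear_combination h15 - 7 * h2)) hb₀0 (by
    rw [hb₀, map_one])
  by_cases h0 : h = 0
  · subst h0
    have hc : (c : ZMod 2) = 0 := by
      rw [ZMod.intCast_zmod_eq_zero_iff_dvd, ← CharP.intCast_eq_zero_iff k 2, ← hh]
      simp
    -- Once x is replaced by 2x, the root 1 + 2z of 1 + 4x requires z² + z = x. Working over 𝔽₂
    -- first keeps the residue of x in {0, 1}, where 0 or ω solves this equation in k.
    obtain ⟨y, x, hyx, hya, hy, hx⟩ := hsqrt (F := ZMod 2) 0 (by simp [hc])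
    obtain ⟨x, rfl⟩ := (WittVector.constantCoeff_eq_zero_iff x).mp hx
    push_cast at hyx
    let φ : ZMod 2 →+* k := ZMod.castHom dvd_rfl k
    let ι : WittVector 2 (ZMod 2) →+* WittVector 2 k := WittVector.map φ
    have hι : ∀ w, WittVector.constantCoeff (ι w) = φ (WittVector.constantCoeff w) :=
      fun w => WittVector.map_coeff φ w 0
    obtain ⟨v, hv⟩ : ∃ v : k, v ^ 2 + v = WittVector.constantCoeff (ι x) := by
      rw [hι]
      generalize WittVector.constantCoeff x = w
      have : w = 0 ∨ w = 1 := by revert w; decide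
      rcases this with rfl | rfl
      · exact ⟨0, by simp⟩
      · exact ⟨ω, by simp [hω]⟩
    obtain ⟨z, hz, -⟩ := WittVector.exists_root (p := 2) (k := k) (b := v)
      (f := X ^ 2 + X - C (ι x)) (by monicity!)
      (by simp [-WittVector.constantCoeff_apply, hv])
      (by
        simp [-WittVector.constantCoeff_apply, eval₂_add, eval₂_mul]
        intro hd
        exact (one_ne_zero : (1 : k) ≠ 0) (by linear_combination hd - v * h2))
    simp only [eval_sub, eval_add, eval_pow, eval_X, eval_C] at hz
    have hτ30 : (ρ * (1 + 2 * z)) ^ 30 = 1 + 2 * ι y := by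
      have h3 := congrArg ι hyx
      simp only [map_add, map_mul, map_pow, map_one, map_ofNat] at h3
      have h4 : (1 + 2 * z) ^ 2 = 1 + 2 * (2 * ι x) := by linear_combination 4 * hz
      rw [mul_pow, show 30 = 15 * 2 by norm_num, pow_mul, hρ, mul_comm 15 2, pow_mul _ 2, h4, h3,
        one_pow, one_mul]
    have hτ60 : (ρ * (1 + 2 * z)) ^ 60 = a := by
      rw [show 60 = 30 * 2 by norm_num, pow_mul, hτ30]
      have h3 := congrArg ι hya
      simpa only [map_add, map_mul, map_pow, map_one, map_ofNat, map_intCast] using h3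
    obtain ⟨f, hf, hfe⟩ := exists_residue_hom hmin htop hβ
      (WittVector.constantCoeff : WittVector 2 k →+* k) hτ60 (hfη (by rw [hτ30, add_comm]))
    refine ⟨f, ?_, ?_⟩
    · rw [hf, map_mul, map_add, map_mul, map_ofNat, h2, hρb, map_one, zero_mul, add_zero, mul_one]
    · rw [hfe, hι, hy, map_zero]
  · obtain ⟨y, x, hyx, hya, hy, hx⟩ := hsqrt h hh
    -- Now x is a unit, so the equation (1 + t)² = 1 + 2x is Eisenstein in t.
    have hE2 : (X ^ 2 + C 2 * X - C (2 * x) : (WittVector 2 k)[X]).natDegree = 2 := by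
      compute_degree!
    obtain ⟨B, _, _, _, ι, t, σ, hι, ht, hσ, hσt⟩ := exists_eisenstein_extension
      (WittVector.constantCoeff : WittVector 2 k →+* k) (WittVector.constantCoeff_surjective 2)
      WittVector.constantCoeff_eq_zero_iff (E := X ^ 2 + C 2 * X - C (2 * x)) (by monicity!)
      (by rw [hE2]; norm_num) (by
        rw [hE2]
        intro i hi
        interval_cases i
        · simp [-map_mul, coeff_C]
        · simp [-map_mul, coeff_C]) (by
        simp only [coeff_sub, coeff_add, coeff_X_pow, coeff_C_mul, coeff_X_zero, coeff_C_zero]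
        rintro ⟨w, hw⟩
        push_cast at hw
        have h3 : x = (2 : ℕ) * (-w) := by
          apply mul_left_cancel₀ (two_ne_zero : (2 : WittVector 2 k) ≠ 0)
          simp at hw
          push_cast
          linear_combination -hw
        exact h0 (hx ▸ (WittVector.constantCoeff_eq_zero_iff x).mpr ⟨_, h3⟩))
    have : CharZero B := charZero_of_injective_ringHom hι
    have ht' : (1 + t) ^ 2 = 1 + 2 * ι x := by
      simp [eval₂_add, eval₂_mul, map_ofNat ι] at ht
      linear_combination ht
    have hτ30 : (ι ρ * (1 + t)) ^ 30 = 1 + 2 * ι y := by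
      have h3 := congrArg ι hyx
      simp only [map_add, map_mul, map_pow, map_one, map_ofNat] at h3
      rw [mul_pow, show 30 = 15 * 2 by norm_num, pow_mul, ← map_pow, hρ, mul_comm 15 2,
        pow_mul _ 2, ht', h3, map_one, one_pow, one_mul]
    have hτ60 : (ι ρ * (1 + t)) ^ 60 = a := by
      rw [show 60 = 30 * 2 by norm_num, pow_mul, hτ30]
      have h3 := congrArg ι hya
      simpa only [map_add, map_mul, map_pow, map_one, map_ofNat, map_intCast] using h3
    obtain ⟨f, hf, hfe⟩ := exists_residue_hom hmin htop hβ σ hτ60 (hfη (by rw [hτ30, add_comm]))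
    refine ⟨f, ?_, ?_⟩
    · rw [hf, map_mul, map_add, map_one, hσt, hσ, hρb, add_zero, mul_one]
    · rw [hfe, hσ, hy]

/-! ### Counting homomorphisms to exclude monogenicity -/

/-- If `𝓞 K = ℤ[θ]`, then ring homomorphisms out of `𝓞 K` are determined by their values at `θ`, so
too many of them into the same finite field prevent `K` from being monogenic. -/
lemma not_isMonogenicField_of_card_lt {K : Type*} [Field K] [CharZero K] {k : Type*} [Field k]
    (β η : NumberField.RingOfIntegers K) (S : Finset (k × k)) (T : Finset k)
    (hcard : T.card < S.card)
    (hS : ∀ s ∈ S, ∃ f : NumberField.RingOfIntegers K →+* k, f β = s.1 ∧ f η = s.2)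
    (hT : ∀ f : NumberField.RingOfIntegers K →+* k, (f β, f η) ∈ S →
      ∀ θ : NumberField.RingOfIntegers K, Algebra.adjoin ℤ {θ} = ⊤ → f θ ∈ T) :
    ¬ IsMonogenicField K := by
  rintro ⟨θ, -, hθ⟩
  choose F hF using hS
  obtain ⟨s, -, t, -, hst, h⟩ := Finset.exists_ne_map_eq_of_card_lt_of_maps_to
    (s := S.attach) (t := T) (f := fun s => F s.1 s.2 θ) (by simpa using hcard)
    (fun s _ => hT _ (by rw [(hF s.1 s.2).1, (hF s.1 s.2).2]; exact s.2) θ hθ)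
  have heq : F s.1 s.2 = F t.1 t.2 := by
    have : (F s.1 s.2).toIntAlgHom = (F t.1 t.2).toIntAlgHom := by
      apply AlgHom.ext_of_adjoin_eq_top hθ
      rintro x rfl
      exact h
    ext x
    exact congrArg (fun g => g x) this
  apply hst
  apply Subtype.ext
  apply Prod.ext
  · rw [← (hF s.1 s.2).1, heq, (hF t.1 t.2).1]
  · rw [← (hF s.1 s.2).2, heq, (hF t.1 t.2).2]

/-- Every nonzero x has x^m = ±1, and at most m elements satisfy x^m = 1. -/
lemma le_card_filter_pow_eq_neg_one {k : Type*} [Field k] [Fintype k] [DecidableEq k] {m : ℕ}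
    (hm : 0 < m) (hk : Fintype.card k = 2 * m + 1) :
    m ≤ (Finset.univ.filter fun x : k => x ^ m = -1).card := by
  have h1 : (Finset.univ.filter fun x : k => x ^ m = 1).card ≤ m := by
    refine le_trans ?_ (card_nthRoots m (1 : k))
    refine le_trans (Finset.card_le_card (t := (nthRoots m (1 : k)).toFinset) ?_)
      (Multiset.toFinset_card_le _)
    intro x hx
    simpa [mem_nthRoots hm] using hx
  have h2 : (Finset.univ : Finset k) ⊆ ({0} ∪ Finset.univ.filter fun x : k => x ^ m = 1) ∪
      Finset.univ.filter fun x : k => x ^ m = -1 := by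
    intro x _
    by_cases hx : x = 0
    · simp [hx]
    · have := FiniteField.pow_card_sub_one_eq_one x hx
      rw [hk, Nat.add_sub_cancel, mul_comm, pow_mul, sq, mul_self_eq_one_iff] at this
      rcases this with h | h <;> simp [h]
  have h3 := (Finset.card_le_card h2).trans ((Finset.card_union_le _ _).trans
    (Nat.add_le_add_right (Finset.card_union_le _ _) _))
  rw [Finset.card_univ, hk, Finset.card_singleton] at h3
  omega

lemma card_filter_pow_ne_self_le {k : Type*} [Field k] [Fintype k] [DecidableEq k] (p : ℕ)
    [Fact p.Prime] [CharP k p] :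
    (Finset.univ.filter fun x : k => x ^ p ≠ x).card + p ≤ Fintype.card k := by
  have h1 : p ≤ (Finset.univ.filter fun x : k => x ^ p = x).card := by
    have : (Finset.univ.image (ZMod.castHom (dvd_refl p) k)).card = p := by
      rw [Finset.card_image_of_injective _ (ZMod.castHom_injective k), Finset.card_univ, ZMod.card]
    refine this.symm.trans_le (Finset.card_le_card ?_)
    intro x hx
    obtain ⟨y, -, rfl⟩ := Finset.mem_image.mp hx
    rw [Finset.mem_filter, ← map_pow, ZMod.pow_card]
    exact ⟨Finset.mem_univ _, rfl⟩
  have h2 := Finset.card_filter_add_card_filter_not (s := (Finset.univ : Finset k))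
    (fun x : k => x ^ p = x)
  rw [Finset.card_univ] at h2
  simp only [ne_eq]
  omega

/-- The field 𝔽₄ contains the roots of y² + y = c for either parity of c. Three nonzero values of β
times two of η give 6 homomorphisms, against 4 values of θ. -/
lemma not_isMonogenicField_of_one_mod_four {K : Type*} [Field K] [CharZero K] {b : K} {a : ℤ}
    (hmin : minpoly ℚ b = X ^ 60 - C (a : ℚ)) (htop : ℚ⟮b⟯ = ⊤) (hpow : b ^ 60 = a)
    {β : NumberField.RingOfIntegers K} (hβ : (β : K) = b) {c : ℤ} (ha : a = 1 + 4 * c) :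
    ¬ IsMonogenicField K := by
  classical
  have haK : b ^ 60 = 1 + 4 * (c : K) := by rw [hpow, ha]; push_cast; ring
  obtain ⟨η, hη⟩ : ∃ η : NumberField.RingOfIntegers K, (η : K) = (b ^ 30 - 1) / 2 := by
    refine ⟨⟨(b ^ 30 - 1) / 2, X ^ 2 + X - C c, by monicity!, ?_⟩, rfl⟩
    rw [← aeval_def]
    simp
    linear_combination (1 / 4) * haK
  have hη' : 2 * η + 1 = β ^ 30 := by
    apply NumberField.RingOfIntegers.coe_injective
    simp [hη, hβ, map_ofNat (algebraMap (NumberField.RingOfIntegers K) K)]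
    ring
  have : Fact (Nat.Prime 2) := ⟨Nat.prime_two⟩
  let k := GaloisField 2 2
  let _ : Fintype k := Fintype.ofFinite k
  have hk : Fintype.card k = 4 := by
    rw [← Nat.card_eq_fintype_card, GaloisField.card 2 2 (by norm_num)]
    norm_num
  have h2 : (2 : k) = 0 := by exact_mod_cast CharP.cast_eq_zero k 2
  obtain ⟨ω, hω⟩ : ∃ ω : k, ω ^ 2 + ω = 1 := by
    obtain ⟨ω, -, hω⟩ := Finset.exists_mem_notMem_of_card_lt_card
      (s := ({0, 1} : Finset k)) (t := Finset.univ) (by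
        rw [Finset.card_univ, hk]; exact Finset.card_le_two.trans_lt (by norm_num))
    simp only [Finset.mem_insert, Finset.mem_singleton, not_or] at hω
    have h4 := FiniteField.pow_card ω
    rw [hk] at h4
    have h5 : ω * (ω - 1) * (ω ^ 2 + ω + 1) = 0 := by linear_combination h4
    have h6 := (mul_eq_zero.mp h5).resolve_left (mul_ne_zero hω.1 (sub_ne_zero.mpr hω.2))
    exact ⟨ω, by linear_combination h6 - h2⟩
  obtain ⟨h, hh⟩ : ∃ h : k, h ^ 2 + h = c := by
    rcases Int.even_or_odd' c with ⟨d, rfl | rfl⟩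
    · exact ⟨0, by push_cast; linear_combination -(d : k) * h2⟩
    · exact ⟨ω, by push_cast; linear_combination hω - (d : k) * h2⟩
  have hh' : (h + 1) ^ 2 + (h + 1) = c := by linear_combination hh + (h + 1) * h2
  refine not_isMonogenicField_of_card_lt β η (({0}ᶜ : Finset k) ×ˢ {h, h + 1}) Finset.univ ?_ ?_
    (fun _ _ _ _ => Finset.mem_univ _)
  · rw [Finset.card_product, Finset.card_compl, Finset.card_singleton, Finset.card_univ, hk,
      Finset.card_pair (by simp)]
    norm_num
  · rintro ⟨x, y⟩ hxy
    simp only [Finset.mem_product, Finset.mem_compl, Finset.mem_singleton, Finset.mem_insert] at hxy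
    have hx : x ^ 15 = 1 := by
      have := FiniteField.pow_card_sub_one_eq_one x hxy.1
      rw [hk] at this
      rw [show 15 = (4 - 1) * 5 by norm_num, pow_mul, this, one_pow]
    refine exists_residue_hom_two hmin htop hβ ha hη' hx hω ?_
    rcases hxy.2 with rfl | rfl
    exacts [hh, hh']

/-- The values at the generator `θ` avoid the prime field as soon as the homomorphism does not have
values in the prime field. -/
lemma map_generator_mem_filter {R k : Type*} [CommRing R] [Field k] [Fintype k]
    [DecidableEq k] (p : ℕ) [Fact p.Prime] [CharP k p] (f : R →+* k) {β θ : R}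
    (hθ : Algebra.adjoin ℤ {θ} = ⊤) (hβ : f β ^ p ≠ f β) :
    f θ ∈ Finset.univ.filter fun x : k => x ^ p ≠ x := by
  simp only [Finset.mem_filter, Finset.mem_univ, true_and]
  intro h
  have : ((frobenius k p).comp f).toIntAlgHom = f.toIntAlgHom := by
    apply AlgHom.ext_of_adjoin_eq_top hθ
    rintro x rfl
    simpa [frobenius_def] using h
  apply hβ
  simpa [frobenius_def] using congrArg (fun g => g β) this

/-- For ε = 1 there are 2 · 2 homomorphisms to 𝔽₃, against 3 values. For ε = -1 there are at least 4
· 2 to 𝔽₉ with β outside 𝔽₃; θ is then outside 𝔽₃ too, leaving at most 6 values. -/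
lemma not_isMonogenicField_of_mod_nine {K : Type*} [Field K] [CharZero K] {b : K} {a : ℤ}
    (hmin : minpoly ℚ b = X ^ 60 - C (a : ℚ)) (htop : ℚ⟮b⟯ = ⊤) (hpow : b ^ 60 = a)
    {β : NumberField.RingOfIntegers K} (hβ : (β : K) = b) {ε c : ℤ} (hε : ε = 1 ∨ ε = -1)
    (ha : ε * a = 1 + 9 * c) (hc : c ≠ 0) :
    ¬ IsMonogenicField K := by
  have hε2 : ε ^ 2 = 1 := by rcases hε with rfl | rfl <;> norm_num
  obtain ⟨η, hη⟩ : ∃ η : NumberField.RingOfIntegers K,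
      3 * η = 1 + ε * β ^ 20 + (ε * β ^ 20) ^ 2 := by
    obtain ⟨D, hD⟩ : ∃ D : K, D = ε * b ^ 20 := ⟨_, rfl⟩
    obtain ⟨y, hy⟩ : ∃ y : K, 3 * y = 1 + D + D ^ 2 := ⟨(1 + D + D ^ 2) / 3, by ring⟩
    have hc' : (c : K) ≠ 0 := by exact_mod_cast hc
    have hεK : (ε : K) ^ 2 = 1 := by exact_mod_cast hε2
    have haK : (ε : K) * a = 1 + 9 * c := by exact_mod_cast ha
    have hD3 : D ^ 3 = 1 + 9 * c := by
      rw [hD, ← haK, ← hpow]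
      linear_combination (ε * b ^ 60) * hεK
    have h1 : D * y = y + 3 * c := by linear_combination (1 / 3) * (D - 1) * hy + (1 / 3) * hD3
    have h2 : (y + 3 * c) ^ 3 = (1 + 9 * c) * y ^ 3 := by rw [← h1, mul_pow, hD3]
    have hint : IsIntegral ℤ y := by
      -- Expanding (y + 3c)³ = (1 + 9c) y³ and dividing by 9c gives this polynomial; hence the need
      -- for c ≠ 0.
      refine ⟨X ^ 3 - X ^ 2 - C (3 * c) * X - C (3 * c ^ 2), by monicity!, ?_⟩
      rw [← aeval_def]
      simp [map_ofNat (aeval y)]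
      apply mul_left_cancel₀ (mul_ne_zero (by norm_num : (9 : K) ≠ 0) hc')
      linear_combination -h2
    refine ⟨⟨y, hint⟩, NumberField.RingOfIntegers.coe_injective ?_⟩
    simp [hβ, ← hD]
    exact hy
  have hcard : 3 < ((Finset.univ.filter fun x : ZMod 3 => x ^ 20 = 1) ×ˢ
      ({0, 1} : Finset (ZMod 3))).card := by decide
  have : Fact (Nat.Prime 3) := ⟨Nat.prime_three⟩
  rcases hε with rfl | rfl
  · refine not_isMonogenicField_of_card_lt β η
      ((Finset.univ.filter fun x : ZMod 3 => x ^ 20 = 1) ×ˢ {0, 1}) Finset.univ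
      (by rw [Finset.card_univ, ZMod.card]; exact hcard) ?_
      (fun _ _ _ _ => Finset.mem_univ _)
    rintro ⟨x, y⟩ hxy
    simp only [Finset.mem_product, Finset.mem_filter, Finset.mem_singleton, Finset.mem_insert] at hxy
    exact exists_residue_hom_three hmin htop hβ hε2 ha hη (by simpa using hxy.1.2) hxy.2
  · classical
    let k := GaloisField 3 2
    let _ : Fintype k := Fintype.ofFinite k
    have hk : Fintype.card k = 9 := by
      rw [← Nat.card_eq_fintype_card, GaloisField.card 3 2 (by norm_num)]
      norm_num
    have h3 : (3 : k) = 0 := by exact_mod_cast CharP.cast_eq_zero k 3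
    refine not_isMonogenicField_of_card_lt β η
      ((Finset.univ.filter fun x : k => x ^ 4 = -1) ×ˢ {0, 1})
      (Finset.univ.filter fun x : k => x ^ 3 ≠ x) ?_ ?_ ?_
    · have h1 := le_card_filter_pow_eq_neg_one (k := k) (m := 4) (by norm_num) hk
      have h2 := card_filter_pow_ne_self_le (k := k) 3
      rw [hk] at h2
      rw [Finset.card_product, Finset.card_pair zero_ne_one]
      omega
    · rintro ⟨x, y⟩ hxy
      simp only [Finset.mem_product, Finset.mem_filter, Finset.mem_singleton,
        Finset.mem_insert] at hxy
      refine exists_residue_hom_three hmin htop hβ hε2 ha hη ?_ hxy.2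
      rw [show 20 = 4 * 5 by norm_num, pow_mul, hxy.1.2]
      push_cast
      norm_num
    · intro f hf θ hθ
      simp only [Finset.mem_product, Finset.mem_filter, Finset.mem_univ, true_and] at hf
      refine map_generator_mem_filter 3 f hθ (β := β) fun h => ?_
      have h1 : f β ^ 4 = f β ^ 2 := by linear_combination f β * h
      have h2 : f β ^ 4 = 1 := by
        calc f β ^ 4 = (f β ^ 2) ^ 2 := by ring
          _ = 1 := by rw [← h1, hf.1]; norm_num
      exact (one_ne_zero : (1 : k) ≠ 0) (by linear_combination h3 + h2 - hf.1)

/-- The counts are 4 · 2 > 5 in 𝔽₅ for ε = 1, and at least 12 · 2 > 20 in 𝔽₂₅ outside 𝔽₅ for ε = -1.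
-/
lemma not_isMonogenicField_of_mod_twenty_five {K : Type*} [Field K] [CharZero K] {b : K} {a : ℤ}
    (hmin : minpoly ℚ b = X ^ 60 - C (a : ℚ)) (htop : ℚ⟮b⟯ = ⊤) (hpow : b ^ 60 = a)
    {β : NumberField.RingOfIntegers K} (hβ : (β : K) = b) {ε c : ℤ} (hε : ε = 1 ∨ ε = -1)
    (ha : ε * a = 1 + 25 * c) (hc : c ≠ 0) :
    ¬ IsMonogenicField K := by
  have hε2 : ε ^ 2 = 1 := by rcases hε with rfl | rfl <;> norm_num
  obtain ⟨η, hη⟩ : ∃ η : NumberField.RingOfIntegers K,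
      5 * η = 1 + ε * β ^ 12 + (ε * β ^ 12) ^ 2 + (ε * β ^ 12) ^ 3 + (ε * β ^ 12) ^ 4 := by
    obtain ⟨D, hD⟩ : ∃ D : K, D = ε * b ^ 12 := ⟨_, rfl⟩
    obtain ⟨y, hy⟩ : ∃ y : K, 5 * y = 1 + D + D ^ 2 + D ^ 3 + D ^ 4 :=
      ⟨(1 + D + D ^ 2 + D ^ 3 + D ^ 4) / 5, by ring⟩
    have hc' : (c : K) ≠ 0 := by exact_mod_cast hc
    have hεK : (ε : K) ^ 2 = 1 := by exact_mod_cast hε2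
    have haK : (ε : K) * a = 1 + 25 * c := by exact_mod_cast ha
    have hD5 : D ^ 5 = 1 + 25 * c := by
      rw [hD, ← haK, ← hpow]
      linear_combination (ε * b ^ 60) * (ε ^ 2 + 1) * hεK
    have h1 : D * y = y + 5 * c := by linear_combination (1 / 5) * (D - 1) * hy + (1 / 5) * hD5
    have h2 : (y + 5 * c) ^ 5 = (1 + 25 * c) * y ^ 5 := by rw [← h1, mul_pow, hD5]
    have hint : IsIntegral ℤ y := by
      refine ⟨X ^ 5 - X ^ 4 - C (10 * c) * X ^ 3 - C (50 * c ^ 2) * X ^ 2 - C (125 * c ^ 3) * X -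
        C (125 * c ^ 4), by monicity!, ?_⟩
      rw [← aeval_def]
      simp [map_ofNat (aeval y)]
      apply mul_left_cancel₀ (mul_ne_zero (by norm_num : (25 : K) ≠ 0) hc')
      linear_combination -h2
    refine ⟨⟨y, hint⟩, NumberField.RingOfIntegers.coe_injective ?_⟩
    simp [hβ, ← hD]
    exact hy
  have hcard : 5 < ((Finset.univ.filter fun x : ZMod 5 => x ^ 12 = 1) ×ˢ
      ({0, 1} : Finset (ZMod 5))).card := by decide
  have : Fact (Nat.Prime 5) := ⟨Nat.prime_five⟩
  rcases hε with rfl | rfl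
  · refine not_isMonogenicField_of_card_lt β η
      ((Finset.univ.filter fun x : ZMod 5 => x ^ 12 = 1) ×ˢ {0, 1}) Finset.univ
      (by rw [Finset.card_univ, ZMod.card]; exact hcard) ?_
      (fun _ _ _ _ => Finset.mem_univ _)
    rintro ⟨x, y⟩ hxy
    simp only [Finset.mem_product, Finset.mem_filter, Finset.mem_singleton, Finset.mem_insert] at hxy
    exact exists_residue_hom_five hmin htop hβ hε2 ha hη (by simpa using hxy.1.2) hxy.2
  · classical
    let k := GaloisField 5 2
    let _ : Fintype k := Fintype.ofFinite k
    have hk : Fintype.card k = 25 := by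
      rw [← Nat.card_eq_fintype_card, GaloisField.card 5 2 (by norm_num)]
      norm_num
    have h5 : (5 : k) = 0 := by exact_mod_cast CharP.cast_eq_zero k 5
    refine not_isMonogenicField_of_card_lt β η
      ((Finset.univ.filter fun x : k => x ^ 12 = -1) ×ˢ {0, 1})
      (Finset.univ.filter fun x : k => x ^ 5 ≠ x) ?_ ?_ ?_
    · have h1 := le_card_filter_pow_eq_neg_one (k := k) (m := 12) (by norm_num) hk
      have h2 := card_filter_pow_ne_self_le (k := k) 5
      rw [hk] at h2
      rw [Finset.card_product, Finset.card_pair zero_ne_one]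
      omega
    · rintro ⟨x, y⟩ hxy
      simp only [Finset.mem_product, Finset.mem_filter, Finset.mem_singleton,
        Finset.mem_insert] at hxy
      refine exists_residue_hom_five hmin htop hβ hε2 ha hη ?_ hxy.2
      rw [hxy.1.2]
      push_cast
      rfl
    · intro f hf θ hθ
      simp only [Finset.mem_product, Finset.mem_filter, Finset.mem_univ, true_and] at hf
      refine map_generator_mem_filter 5 f hθ (β := β) fun h => ?_
      have h1 : f β ^ 12 = f β ^ 8 := by linear_combination f β ^ 7 * h
      have h2 : f β ^ 16 = f β ^ 12 := by linear_combination f β ^ 11 * h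
      have h3 : f β ^ 16 = 1 := by
        calc f β ^ 16 = (f β ^ 8) ^ 2 := by ring
          _ = 1 := by rw [← h1, hf.1]; norm_num
      exact (one_ne_zero : (1 : k) ≠ 0) (by linear_combination h5 + 2 * h3 - 2 * h2 - 2 * hf.1)

/-! ### Reduction to X^60 - a and conclusion -/

/-- With uv = 60m + 1, b = α^v / a^m satisfies b^60 = a and b^u = α. So b generates K, and the
degree 60 forces its minimal polynomial. -/
lemma exists_sixtieth_root {a : ℤ} (ha0 : a ≠ 0) {u : ℕ} (hcop : Nat.Coprime u 30) {α : ℂ}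
    (hirr : Irreducible (X ^ 60 - C (a ^ u) : ℤ[X]))
    (hα : aeval α (X ^ 60 - C (a ^ u) : ℤ[X]) = 0) :
    ∃ b : ℚ⟮α⟯, b ^ 60 = a ∧ ℚ⟮b⟯ = ⊤ ∧ minpoly ℚ b = X ^ 60 - C (a : ℚ) := by
  have hmon : (X ^ 60 - C (a ^ u) : ℤ[X]).Monic := monic_X_pow_sub_C _ (by norm_num)
  have hirrQ := (hmon.irreducible_iff_irreducible_map_fraction_map (K := ℚ)).mp hirr
  have hminα : minpoly ℚ α = (X ^ 60 - C (a ^ u) : ℤ[X]).map (algebraMap ℤ ℚ) :=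
    (minpoly.eq_of_irreducible_of_monic hirrQ (by rw [aeval_map_algebraMap, hα])
      (hmon.map _)).symm
  have hintα : IsIntegral ℚ α := ⟨_, hmon.map (algebraMap ℤ ℚ), by
    rw [← aeval_def, aeval_map_algebraMap, hα]⟩
  have hfin : Module.finrank ℚ ℚ⟮α⟯ = 60 := by
    rw [IntermediateField.adjoin.finrank hintα, hminα, hmon.natDegree_map]
    exact natDegree_X_pow_sub_C
  have hα60 : α ^ 60 = (a : ℂ) ^ u := by
    simpa [sub_eq_zero] using hα
  let g : ℚ⟮α⟯ := AdjoinSimple.gen ℚ α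
  have hg60 : g ^ 60 = (a : ℚ⟮α⟯) ^ u := by
    apply Subtype.ext
    simpa [g] using hα60
  have haK : (a : ℚ⟮α⟯) ≠ 0 := by exact_mod_cast ha0
  have hcop60 : Nat.Coprime u 60 := by
    rw [show 60 = 30 * 2 by norm_num]
    exact hcop.mul_right (hcop.coprime_dvd_right (by norm_num))
  obtain ⟨v, hv⟩ := Nat.exists_mul_mod_eq_one_of_coprime hcop60 (by norm_num)
  obtain ⟨m, hm⟩ : ∃ m, u * v = 60 * m + 1 := ⟨u * v / 60, by omega⟩
  let b : ℚ⟮α⟯ := g ^ v / (a : ℚ⟮α⟯) ^ m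
  have hb60 : b ^ 60 = a := by
    rw [div_pow, ← pow_mul, mul_comm v, pow_mul, hg60, ← pow_mul, ← pow_mul, hm, pow_succ,
      mul_comm m 60, mul_div_cancel_left₀ _ (pow_ne_zero _ haK)]
  have hbu : b ^ u = g := by
    rw [div_pow, ← pow_mul, mul_comm v, hm, pow_succ, pow_mul, hg60, ← pow_mul, ← pow_mul,
      mul_comm m u, mul_div_cancel_left₀ _ (pow_ne_zero _ haK)]
  have hbtop : ℚ⟮b⟯ = ⊤ := by
    have hg : Algebra.adjoin ℚ {g} = ⊤ := by
      have := (adjoin.powerBasis hintα).adjoin_gen_eq_top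
      rwa [adjoin.powerBasis_gen] at this
    have hle : Algebra.adjoin ℚ {g} ≤ ℚ⟮b⟯.toSubalgebra := by
      rw [Algebra.adjoin_le_iff, Set.singleton_subset_iff, ← hbu]
      exact pow_mem (mem_adjoin_simple_self ℚ b) u
    rw [eq_top_iff]
    intro x _
    exact hle (hg ▸ Algebra.mem_top)
  refine ⟨b, hb60, hbtop, ?_⟩
  have hmonb : (X ^ 60 - C (a : ℚ)).Monic := monic_X_pow_sub_C _ (by norm_num)
  have hevb : aeval b (X ^ 60 - C (a : ℚ)) = 0 := by
    rw [map_sub, map_pow, aeval_X, aeval_C, hb60, eq_ratCast, Rat.cast_intCast, sub_self]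
  have hintb : IsIntegral ℚ b := ⟨_, hmonb, hevb⟩
  have hdeg := IntermediateField.adjoin.finrank hintb
  rw [hbtop, IntermediateField.finrank_top', hfin] at hdeg
  have hle : (X ^ 60 - C (a : ℚ)).natDegree ≤ (minpoly ℚ b).natDegree := by
    rw [← hdeg]
    exact natDegree_X_pow_sub_C.le
  exact (eq_of_monic_of_dvd_of_natDegree_le (minpoly.monic hintb) hmonb
    (minpoly.dvd ℚ b hevb) hle).symm

theorem theorem3 (a : ℤ) (u : ℕ) (α : ℂ)
    (ha : Squarefree a) (ha_one : a ≠ 1) (ha_neg_one : a ≠ -1)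
    (hu : 0 < u) (hcop : Nat.Coprime u 30)
    (hirr : Irreducible (X ^ 60 - C (a ^ u) : ℤ[X]))
    (hα : aeval α (X ^ 60 - C (a ^ u) : ℤ[X]) = 0) :
    ((¬ a ≡ 1 [ZMOD 4] ∧
        (¬ a ≡ 1 [ZMOD 9] ∧ ¬ a ≡ -1 [ZMOD 9]) ∧
        (¬ a ≡ 1 [ZMOD 25] ∧ ¬ a ≡ -1 [ZMOD 25] ∧
          ¬ a ≡ 7 [ZMOD 25] ∧ ¬ a ≡ -7 [ZMOD 25])) →
      IsMonogenicField ℚ⟮α⟯) ∧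
    ((a ≡ 1 [ZMOD 4] ∨
        (a ≡ 1 [ZMOD 9] ∨ a ≡ -1 [ZMOD 9]) ∨
        (a ≡ 1 [ZMOD 25] ∨ a ≡ -1 [ZMOD 25])) →
      ¬ IsMonogenicField ℚ⟮α⟯) := by
  obtain ⟨b, hb, htop, hmin⟩ := exists_sixtieth_root ha.ne_zero hcop hirr hα
  obtain ⟨β, hβ⟩ : ∃ β : NumberField.RingOfIntegers ℚ⟮α⟯, (β : ℚ⟮α⟯) = b := by
    refine ⟨⟨b, IsIntegral.of_pow (n := 60) (by norm_num) ?_⟩, rfl⟩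
    rw [hb]
    exact isIntegral_algebraMap (R := ℤ) (x := a)
  refine ⟨fun ⟨h4, h9, h25⟩ => isMonogenicField_of_pow_sixty ha hb htop h4 h9 h25, ?_⟩
  rintro (h | (h | h) | h | h)
  · obtain ⟨c, hc⟩ := h.symm.dvd
    exact not_isMonogenicField_of_one_mod_four hmin htop hb hβ (c := c) (by omega)
  · obtain ⟨c, hc⟩ := h.symm.dvd
    exact not_isMonogenicField_of_mod_nine hmin htop hb hβ (ε := 1) (c := c) (.inl rfl)
      (by omega) (by omega)
  · obtain ⟨c, hc⟩ := h.symm.dvd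
    exact not_isMonogenicField_of_mod_nine hmin htop hb hβ (ε := -1) (c := -c) (.inr rfl)
      (by omega) (by omega)
  · obtain ⟨c, hc⟩ := h.symm.dvd
    exact not_isMonogenicField_of_mod_twenty_five hmin htop hb hβ (ε := 1) (c := c) (.inl rfl)
      (by omega) (by omega)
  · obtain ⟨c, hc⟩ := h.symm.dvd
    exact not_isMonogenicField_of_mod_twenty_five hmin htop hb hβ (ε := -1) (c := -c) (.inr rfl)
      (by omega) (by omega)
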